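/- Let $\mathbb T^3=(\mathbb R/\mathbb Z)^3$, let $p\ge 4$, $q\ge 2$, $\rho>1$, $\ell>1$, $h>0$, and sum over repeated indices. For $F\in\mathbb R^{3\times3}$ let $\Phi(F)=(F,\operatorname{cof}F,\det F)\in\mathbb R^{3\times 3}\times\mathbb R^{3\times 3}\times\mathbb R\simeq\mathbb R^{19}$ with components $\Phi^B$, $B=1,\dots,19$, and write $\xi=(F,\zeta,w)\in\mathbb R^{19}$, $L_{p,q,\rho}=L^p\times L^q\times L^\rho$, all function spaces being over $\mathbb T^3$. Let $\hat e=\hat e(\xi,\eta)\in C^3(\mathbb R^{19}\times[0,\infty))$ be strictly convex, put $\hat\theta=\partial\hat e/\partial\eta$, and assume that for some constants $c>0$, $C$ $$c\,(|F|^p+|\zeta|^q+|w|^\rho+|\eta|^\ell)-C\le\hat e(F,\zeta,w,\eta)\le C\,(|F|^p+|\zeta|^q+|w|^\rho+|\eta|^\ell)+C .\tag{1}$$ Let $v^0\in L^2$, $\xi^0=(F^0,\zeta^0,w^0)\in L_{p,q,\rho}$ and $\eta^0\in L^\ell$ with $\eta^0\ge0$ a.e., and suppose that $F^0=\nabla y^0$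 for some $y^0\in W^{1,p}(\mathbb T^3;\mathbb R^3)$ (for instance $\xi^0=\Phi(\nabla y^0)$, if this lies in $L_{p,q,\rho}$). Let $r:\mathbb T^3\to\mathbb R$ be such that $\hat\theta(\xi^0,\eta^0)\ne0$ a.e., $r/\hat\theta(\xi^0,\eta^0)\in L^\ell$ and $\eta^0+h\,r/\hat\theta(\xi^0,\eta^0)\ge0$ a.e. Let $\mathcal C$ be the set of all $(v,\xi,\eta)\in L^2\times L_{p,q,\rho}\times L^\ell$ such that, for all $\phi\in C^\infty(\mathbb T^3)$ and $B=1,\dots,19$, $$\int\phi\,\tfrac1h(\xi-\xi^0)^B\,dx=-\int\frac{\partial\Phi^B}{\partial F_{i\alpha}}(F^0)\,v_i\,\partial_\alpha\phi\,dx,\qquad \int\phi\,\tfrac1h(\eta-\eta^0)\,dx=\int\frac{r}{\hat\theta(\xi^0,\eta^0)}\,\phi\,dx .$$ Then: 1. $\mathcal C$ is a weakly closed affine subspace of $L^2\times L_{p,q,\rho}\times L^\ell$. Every $(v,\xi,\eta)\in\mathcal C$ satisfies $\eta\ge0$ a.e., and $\tfrac12|v-v^0|^2+\hat e(\xi,\eta)$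 is integrable. 2. There is a unique minimizer $(v,\xi,\eta)\in\mathcal C$ of $$J(v,\xi,\eta)=\int_{\mathbb T^3}\tfrac12|v-v^0|^2+\hat e(\xi,\eta)\,dx$$ over $\mathcal C$. 3. If in addition, for some constant $C$, $$|\partial_F\hat e|^{\frac p{p-1}}+|\partial_\zeta\hat e|^{\frac p{p-2}}+|\partial_w\hat e|^{\frac p{p-3}}\le C\,(|F|^p+|\zeta|^q+|w|^\rho+|\eta|^\ell)+C,$$ then the minimizer satisfies the Euler–Lagrange equation: the functions $\frac{\partial\hat e}{\partial\xi^B}(\xi,\eta)\frac{\partial\Phi^B}{\partial F_{i\alpha}}(F^0)$ are integrable and, for $i=1,2,3$ and all $\phi\in C^\infty(\mathbb T^3)$, $$\int\phi\,\tfrac1h(v_i-v_i^0)\,dx=-\int\frac{\partial\hat e}{\partial\xi^B}(\xi,\eta)\frac{\partial\Phi^B}{\partial F_{i\alpha}}(F^0)\,\partial_\alpha\phi\,dx .$$ 4. The gradient constraint is preserved: for every $(v,\xi,\eta)\in\mathcal C$, $\xi=(F,\zeta,w)$, and in particular for the minimizer, $\partial_\alpha F_{i\beta}=\partial_\beta F_{i\alpha}$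 in the sense of distributions for all $i,\alpha,\beta$, and there is $y\in W^{1,p}(\mathbb T^3;\mathbb R^3)$ with $\partial_\alpha y_i=F_{i\alpha}$. -/

import Mathlib

noncomputable section

open MeasureTheory
open scoped ContDiff

namespace PolyThermo

/-! ### The torus, test functions and weak derivatives -/

/-- The flat torus `𝕋³ = (ℝ/ℤ)³`, with its Haar (probability) measure `volume`. -/
abbrev T3 : Type := UnitAddTorus (Fin 3)

/-- Vectors of `ℝ³` with the Euclidean norm. -/
abbrev V3 : Type := EuclideanSpace ℝ (Fin 3)

/-- Real `3 × 3` matrices with the Euclidean (Frobenius) norm; the entry of `F` in row `i` and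
column `α` is `F (i, α)`. -/
abbrev M3 : Type := EuclideanSpace ℝ (Fin 3 × Fin 3)

/-- `φ ∈ C^∞(𝕋³)`: the periodic lift of `φ` to `ℝ³` is smooth. -/
def SmoothOnTorus (φ : T3 → ℝ) : Prop :=
  ContDiff ℝ ∞ (fun x : V3 => φ (fun i => (x i : UnitAddCircle)))

/-- The partial derivative `∂_α φ` of a function on the torus. -/
def pd (α : Fin 3) (φ : T3 → ℝ) (x : T3) : ℝ :=
  deriv (fun s : ℝ => φ (x + Pi.single α (s : UnitAddCircle))) 0

/-- `∂_α y_i = G_{iα}` in the sense of distributions on `𝕋³`. -/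
def HasWeakGradient (y : T3 → V3) (G : T3 → M3) : Prop :=
  ∀ (i α : Fin 3) (φ : T3 → ℝ), SmoothOnTorus φ →
    ∫ x, G x (i, α) * φ x = - ∫ x, y x i * pd α φ x

/-- `y ∈ W^{1,p}(𝕋³; ℝ³)`. -/
def MemW1 (p : ℝ) (y : T3 → V3) : Prop :=
  MemLp y (ENNReal.ofReal p) volume ∧
    ∃ G : T3 → M3, MemLp G (ENNReal.ofReal p) volume ∧ HasWeakGradient y G

/-- The constraint `∂_α F_{iβ} = ∂_β F_{iα}` in the sense of distributions. -/
def CurlFree (F : T3 → M3) : Prop :=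
  ∀ (i α β : Fin 3) (φ : T3 → ℝ), SmoothOnTorus φ →
    ∫ x, F x (i, β) * pd α φ x = ∫ x, F x (i, α) * pd β φ x

/-! ### The extended variable `ξ = (F, ζ, w) ∈ ℝ¹⁹` and the null Lagrangians -/

/-- The extended variables `ξ = (F, ζ, w)`. -/
abbrev Xi : Type := M3 × M3 × ℝ

/-- The index set of the 19 components `B` of `ξ`. -/
abbrev Idx : Type := (Fin 3 × Fin 3) ⊕ (Fin 3 × Fin 3) ⊕ Unit

/-- The component `ξ^B`. -/
def comp (ξ : Xi) : Idx → ℝ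
  | Sum.inl a => ξ.1 a
  | Sum.inr (Sum.inl a) => ξ.2.1 a
  | Sum.inr (Sum.inr _) => ξ.2.2

/-- The unit vector of `ℝ¹⁹` in direction `B`. -/
def unitVec : Idx → Xi
  | Sum.inl a => (EuclideanSpace.single a 1, 0, 0)
  | Sum.inr (Sum.inl a) => (0, EuclideanSpace.single a 1, 0)
  | Sum.inr (Sum.inr _) => (0, 0, 1)

/-- A vector of `ℝ⁹` as a matrix. -/
def toMat (F : M3) : Matrix (Fin 3) (Fin 3) ℝ := Matrix.of fun i α => F (i, α)

/-- The cofactor matrix, the transpose of the adjugate. -/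
def cof (F : M3) : M3 := WithLp.toLp 2 fun a => (toMat F).adjugate a.2 a.1

/-- The null Lagrangians `Φ(F) = (F, cof F, det F)`. -/
def Phi (F : M3) : Xi := (F, cof F, (toMat F).det)

/-- `∂Φ^B / ∂F_{iα}`, evaluated at `F`. -/
def dPhi (B : Idx) (i α : Fin 3) (F : M3) : ℝ :=
  fderiv ℝ (fun G : M3 => comp (Phi G) B) F (EuclideanSpace.single (i, α) 1)

/-! ### The internal energy -/

/-- The domain `ℝ¹⁹ × [0, ∞)` of the internal energy. -/
def energyDom : Set (Xi × ℝ) := {z | 0 ≤ z.2}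

/-- `∂ê/∂ξ^B`. -/
def dXi (e : Xi × ℝ → ℝ) (B : Idx) (z : Xi × ℝ) : ℝ :=
  fderivWithin ℝ e energyDom z (unitVec B, 0)

/-- The temperature `θ̂ = ∂ê/∂η` (one-sided where `η = 0`). -/
def theta (e : Xi × ℝ → ℝ) (z : Xi × ℝ) : ℝ :=
  fderivWithin ℝ e energyDom z (0, 1)

/-- The matrix `∂ê/∂F`. -/
def dF (e : Xi × ℝ → ℝ) (z : Xi × ℝ) : M3 := WithLp.toLp 2 fun a => dXi e (Sum.inl a) z

/-- The matrix `∂ê/∂ζ`. -/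
def dZeta (e : Xi × ℝ → ℝ) (z : Xi × ℝ) : M3 :=
  WithLp.toLp 2 fun a => dXi e (Sum.inr (Sum.inl a)) z

/-- The scalar `∂ê/∂w`. -/
def dW (e : Xi × ℝ → ℝ) (z : Xi × ℝ) : ℝ := dXi e (Sum.inr (Sum.inr ())) z

/-- The integrability exponents of the problem. -/
structure Exponents where
  p : ℝ
  q : ℝ
  ρ : ℝ
  l : ℝ
  four_le_p : 4 ≤ p
  two_le_q : 2 ≤ q
  one_lt_ρ : 1 < ρ
  one_lt_l : 1 < l

variable (E : Exponents)

instance : Fact (1 ≤ ENNReal.ofReal E.p) :=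
  ⟨ENNReal.one_le_ofReal.2 (by linarith [E.four_le_p])⟩

instance : Fact (1 ≤ ENNReal.ofReal E.q) :=
  ⟨ENNReal.one_le_ofReal.2 (by linarith [E.two_le_q])⟩

instance : Fact (1 ≤ ENNReal.ofReal E.ρ) := ⟨ENNReal.one_le_ofReal.2 E.one_lt_ρ.le⟩

instance : Fact (1 ≤ ENNReal.ofReal E.l) := ⟨ENNReal.one_le_ofReal.2 E.one_lt_l.le⟩

/-- `|F|^p + |ζ|^q + |w|^ρ + |η|^ℓ`. -/
def gauge (z : Xi × ℝ) : ℝ :=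
  ‖z.1.1‖ ^ E.p + ‖z.1.2.1‖ ^ E.q + |z.1.2.2| ^ E.ρ + |z.2| ^ E.l

/-- Growth and coercivity of the energy:
`c (|F|^p + |ζ|^q + |w|^ρ + |η|^ℓ) - C ≤ ê ≤ C (|F|^p + |ζ|^q + |w|^ρ + |η|^ℓ) + C`. -/
def EnergyGrowth (e : Xi × ℝ → ℝ) : Prop :=
  ∃ c C : ℝ, 0 < c ∧ ∀ z ∈ energyDom,
    c * gauge E z - C ≤ e z ∧ e z ≤ C * gauge E z + C

/-- Growth of the derivatives:
`|∂_F ê|^{p/(p-1)} + |∂_ζ ê|^{p/(p-2)} + |∂_w ê|^{p/(p-3)}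
  ≤ C (|F|^p + |ζ|^q + |w|^ρ + |η|^ℓ) + C`. -/
def DerivGrowth (e : Xi × ℝ → ℝ) : Prop :=
  ∃ C : ℝ, ∀ z ∈ energyDom,
    ‖dF e z‖ ^ (E.p / (E.p - 1)) + ‖dZeta e z‖ ^ (E.p / (E.p - 2))
      + |dW e z| ^ (E.p / (E.p - 3)) ≤ C * gauge E z + C

/-! ### States, constraints and the functional -/

/-- The space `L² × (L^p × L^q × L^ρ) × L^ℓ` of states `U = (v, (F, ζ, w), η)` on `𝕋³`. -/
abbrev State : Type :=
  Lp V3 2 (volume : Measure T3) ×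
    (Lp M3 (ENNReal.ofReal E.p) (volume : Measure T3) ×
      Lp M3 (ENNReal.ofReal E.q) (volume : Measure T3) ×
      Lp ℝ (ENNReal.ofReal E.ρ) (volume : Measure T3)) ×
    Lp ℝ (ENNReal.ofReal E.l) (volume : Measure T3)

variable {E}

/-- The velocity `v`. -/
def vel (U : State E) : T3 → V3 := U.1

/-- The first component `F` of `ξ`. -/
def defGrad (U : State E) : T3 → M3 := U.2.1.1

/-- The extended variable `ξ = (F, ζ, w)`. -/
def xi (U : State E) (x : T3) : Xi := (U.2.1.1 x, U.2.1.2.1 x, U.2.1.2.2 x)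

/-- The entropy `η`. -/
def ent (U : State E) : T3 → ℝ := U.2.2

/-- The pair `(ξ, η)`. -/
def xiEnt (U : State E) (x : T3) : Xi × ℝ := (xi U x, ent U x)

/-- The discrete transport equations
`(ξ - ξ⁰)^B / h = ∂_α (∂Φ^B/∂F_{iα}(F⁰) v_i)` in the sense of distributions. -/
def TransportEq (h : ℝ) (U0 U : State E) : Prop :=
  ∀ (B : Idx) (φ : T3 → ℝ), SmoothOnTorus φ →
    ∫ x, φ x * (1 / h * (comp (xi U x) B - comp (xi U0 x) B))
      = - ∫ x, ∑ i, ∑ α, dPhi B i α (defGrad U0 x) * vel U x i * pd α φ x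

/-- The discrete entropy equation `(η - η⁰) / h = r / θ̂(ξ⁰, η⁰)` in the sense of distributions. -/
def EntropyEq (e : Xi × ℝ → ℝ) (r : T3 → ℝ) (h : ℝ) (U0 U : State E) : Prop :=
  ∀ φ : T3 → ℝ, SmoothOnTorus φ →
    ∫ x, φ x * (1 / h * (ent U x - ent U0 x)) = ∫ x, r x / theta e (xiEnt U0 x) * φ x

/-- The set `𝒞` of admissible states. -/
def admissible (e : Xi × ℝ → ℝ) (r : T3 → ℝ) (h : ℝ) (U0 : State E) : Set (State E) :=
  {U | TransportEq h U0 U ∧ EntropyEq e r h U0 U}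

/-- The integrand `½ |v - v⁰|² + ê(ξ, η)`. -/
def energyDensity (e : Xi × ℝ → ℝ) (U0 U : State E) (x : T3) : ℝ :=
  1 / 2 * ‖vel U x - vel U0 x‖ ^ 2 + e (xiEnt U x)

/-- The functional `J(v, ξ, η) = ∫ ½ |v - v⁰|² + ê(ξ, η) dx`. -/
def J (e : Xi × ℝ → ℝ) (U0 U : State E) : ℝ := ∫ x, energyDensity e U0 U x

/-- `U` minimizes `J` over the admissible states. -/
def IsMinimizer (e : Xi × ℝ → ℝ) (r : T3 → ℝ) (h : ℝ) (U0 U : State E) : Prop :=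
  U ∈ admissible e r h U0 ∧ ∀ V ∈ admissible e r h U0, J e U0 U ≤ J e U0 V

/-- The stress `∂ê/∂ξ^B(ξ, η) ∂Φ^B/∂F_{iα}(F⁰)` (summed over `B`). -/
def stress (e : Xi × ℝ → ℝ) (U0 U : State E) (i α : Fin 3) (x : T3) : ℝ :=
  ∑ B, dXi e B (xiEnt U x) * dPhi B i α (defGrad U0 x)

/-- The discrete momentum (Euler–Lagrange) equation
`(v - v⁰)_i / h = ∂_α (∂ê/∂ξ^B(ξ, η) ∂Φ^B/∂F_{iα}(F⁰))` in the sense of distributions, the stress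
being integrable. -/
def MomentumEq (e : Xi × ℝ → ℝ) (h : ℝ) (U0 U : State E) : Prop :=
  (∀ i α : Fin 3, Integrable (stress e U0 U i α) volume) ∧
  ∀ (i : Fin 3) (φ : T3 → ℝ), SmoothOnTorus φ →
    ∫ x, φ x * (1 / h * (vel U x i - vel U0 x i))
      = - ∫ x, ∑ α, stress e U0 U i α x * pd α φ x

end PolyThermo

end

open PolyThermo MeasureTheory

noncomputable section

open MeasureTheory
open scoped ContDiff

namespace PolyThermo

/-! The data `U0` are frozen, so both constraints are linear in `(v, ξ, η)`. Each is a family of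
level sets of linear forms that see only `v ∈ L²` and `(ξ, η) ∈ L¹`; since `p ≥ 4`, the coefficients
`∂Φ/∂F(F⁰)` lie in `L²` and pair with `v`. Hence `𝒞` is affine and closed, and weakly closed because
it is convex. The entropy equation fixes `η = η⁰ + h r/θ̂⁰` by the fundamental lemma, and this is
nonnegative by hypothesis.

Existence and uniqueness rest on one estimate rather than on weak compactness. By `J_midpoint`, the
convexity gap of `J` at the midpoint of two states is `⅛‖v - v'‖²` plus the integral of the
convexity defect of `ê`. Strict convexity on compact sets and superlinear growth at infinity bound
`|z - z'|` by the defect up to a small multiple of the gauge (`norm_sub_le_defect`). So almost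
minimizers are close in `L² × L¹` (`dist_almost_minimizers`): minimizers coincide and minimizing
sequences converge strongly. Fatou's lemma and coercivity put the limit back into the state space
with no larger energy.

For the Euler–Lagrange equation the state is varied along `v = φ e_i`, `ξ^B = h ∂Φ^B/∂F_{iα}(F⁰)
∂_αφ`, `η = 0`. This direction preserves the transport equations by the Piola identity
`∂_α(∂Φ^B/∂F_{iα}(∇y⁰)) = 0`. For the determinant that identity is the `L²`-orthogonality of
gradients and divergence-free fields, proved by Fourier series. The direction has the integrability
required of a state because the growth of the derivatives, compared with coercivity, forces `2q ≤ p`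
and `3ρ ≤ p`. Convexity dominates the difference quotients, and the signs `±φ` turn the variational
inequality into an equation.

The `F`-components of the transport equations say `F = ∇(y⁰ + h v)`. As `v` is only in `L²`, a
potential in `L^p` is built separately: a curl-free field of mean zero is integrated along segments
and averaged over their end points. -/

instance : IsProbabilityMeasure (volume : Measure UnitAddCircle) :=
  ⟨UnitAddCircle.measure_univ⟩

instance : IsProbabilityMeasure (volume : Measure T3) := by
  unfold T3 UnitAddTorus; infer_instance

instance : Measure.IsAddLeftInvariant (volume : Measure T3) := by
  unfold T3 UnitAddTorus; infer_instance

instance : Measure.IsAddHaarMeasure (volume : Measure T3) := by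
  unfold T3 UnitAddTorus; infer_instance

instance : (volume : Measure T3).Regular := by
  unfold T3 UnitAddTorus; infer_instance

instance : Measure.IsNegInvariant (volume : Measure T3) := by
  unfold T3 UnitAddTorus; infer_instance

/-- The projection `ℝ³ → 𝕋³`. -/
def torusMk (x : V3) : T3 := fun i => (x i : UnitAddCircle)

theorem torusMk_add (x y : V3) : torusMk (x + y) = torusMk x + torusMk y := by
  ext i; simp [torusMk]

theorem torusMk_zero : torusMk 0 = 0 := by
  ext i; simp [torusMk]

theorem torusMk_neg (x : V3) : torusMk (-x) = -torusMk x := by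
  ext i; simp [torusMk]

theorem torusMk_single (α : Fin 3) (s : ℝ) :
    torusMk (s • EuclideanSpace.single α 1) = Pi.single α (s : UnitAddCircle) := by
  ext i
  by_cases hi : i = α
  · subst hi; simp [torusMk]
  · simp [torusMk, hi]

theorem isOpenQuotientMap_torusMk : IsOpenQuotientMap torusMk := by
  have h1 : IsOpenQuotientMap (fun x : Fin 3 → ℝ => fun i => (x i : UnitAddCircle)) :=
    IsOpenQuotientMap.piMap fun _ => QuotientAddGroup.isOpenQuotientMap_mk
  exact h1.comp (EuclideanSpace.equiv (Fin 3) ℝ).toHomeomorph.isOpenQuotientMap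

theorem continuous_torusMk : Continuous torusMk := isOpenQuotientMap_torusMk.continuous

theorem torusMk_surjective : Function.Surjective torusMk := isOpenQuotientMap_torusMk.surjective

theorem smoothOnTorus_iff {φ : T3 → ℝ} : SmoothOnTorus φ ↔ ContDiff ℝ ∞ (φ ∘ torusMk) := Iff.rfl

/-! ### Calculus of smooth test functions on the torus -/

namespace SmoothOnTorus

variable {φ ψ : T3 → ℝ}

protected theorem continuous (hφ : SmoothOnTorus φ) : Continuous φ :=
  isOpenQuotientMap_torusMk.continuous_comp_iff.1 (smoothOnTorus_iff.1 hφ).continuous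

protected theorem const (c : ℝ) : SmoothOnTorus fun _ => c := contDiff_const

protected theorem mul (hφ : SmoothOnTorus φ) (hψ : SmoothOnTorus ψ) :
    SmoothOnTorus fun x => φ x * ψ x := ContDiff.mul hφ hψ

protected theorem neg (hφ : SmoothOnTorus φ) : SmoothOnTorus fun x => -φ x := ContDiff.neg hφ

theorem comp_add_right (hφ : SmoothOnTorus φ) (a : T3) : SmoothOnTorus fun x => φ (x + a) := by
  obtain ⟨a, rfl⟩ := torusMk_surjective a
  have : ContDiff ℝ ∞ ((φ ∘ torusMk) ∘ fun x => x + a) := ContDiff.comp hφ (by fun_prop)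
  rw [smoothOnTorus_iff]
  convert this using 1
  ext x; simp [torusMk_add]

theorem hasDerivAt_line (hφ : SmoothOnTorus φ) (x t : V3) (s : ℝ) :
    HasDerivAt (fun s : ℝ => φ (torusMk (x + s • t)))
      (fderiv ℝ (φ ∘ torusMk) (x + s • t) t) s := by
  have h1 : HasFDerivAt (φ ∘ torusMk) (fderiv ℝ (φ ∘ torusMk) (x + s • t)) (x + s • t) :=
    ((smoothOnTorus_iff.1 hφ).differentiable (by simp) _).hasFDerivAt
  have h2 : HasDerivAt (fun s : ℝ => x + s • t) t s := by
    simpa using ((hasDerivAt_id s).smul_const t).const_add x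
  exact h1.comp_hasDerivAt s h2

theorem pd_torusMk (hφ : SmoothOnTorus φ) (α : Fin 3) (x : V3) :
    pd α φ (torusMk x) = fderiv ℝ (φ ∘ torusMk) x (EuclideanSpace.single α 1) := by
  have := (hφ.hasDerivAt_line x (EuclideanSpace.single α 1) 0).deriv
  simpa [pd, torusMk_add, torusMk_single] using this

protected theorem pd (hφ : SmoothOnTorus φ) (α : Fin 3) : SmoothOnTorus (pd α φ) := by
  have h1 : ContDiff ℝ ∞ fun x => fderiv ℝ (φ ∘ torusMk) x (EuclideanSpace.single α 1) :=
    ((smoothOnTorus_iff.1 hφ).fderiv_right (m := ∞) (by simp)).clm_apply contDiff_const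
  rw [smoothOnTorus_iff]
  convert h1 using 1
  ext x; exact hφ.pd_torusMk α x

theorem fderiv_eq_sum (hφ : SmoothOnTorus φ) (x t : V3) :
    fderiv ℝ (φ ∘ torusMk) x t = ∑ β, t β * pd β φ (torusMk x) := by
  have : t = ∑ β, t β • EuclideanSpace.single β (1 : ℝ) := by
    ext i; simp [Finset.sum_apply, Pi.single_apply]
  conv_lhs => rw [this]
  simp [hφ.pd_torusMk]

theorem hasDerivAt_add_line (hφ : SmoothOnTorus φ) (x : T3) (t : V3) (s : ℝ) :
    HasDerivAt (fun s : ℝ => φ (x + torusMk (s • t)))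
      (∑ β, t β * pd β φ (x + torusMk (s • t))) s := by
  obtain ⟨x, rfl⟩ := torusMk_surjective x
  have := hφ.hasDerivAt_line x t s
  rw [hφ.fderiv_eq_sum] at this
  simpa [torusMk_add] using this

theorem sub_eq_integral (hφ : SmoothOnTorus φ) (x : T3) (t : V3) :
    φ (x + torusMk t) - φ x
      = ∫ s in (0 : ℝ)..1, ∑ β, t β * pd β φ (x + torusMk (s • t)) := by
  rw [intervalIntegral.integral_eq_sub_of_hasDerivAt
    (fun s _ => hφ.hasDerivAt_add_line x t s)]
  · simp [torusMk_zero]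
  · refine Continuous.intervalIntegrable ?_ _ _
    refine continuous_finsetSum _ fun β _ => continuous_const.mul ?_
    exact (hφ.pd β).continuous.comp (continuous_const.add
      (continuous_torusMk.comp (continuous_id.smul continuous_const)))

theorem hasDerivAt_pd (hφ : SmoothOnTorus φ) (α : Fin 3) (x : T3) :
    HasDerivAt (fun s : ℝ => φ (x + Pi.single α (s : UnitAddCircle))) (pd α φ x) 0 := by
  have := hφ.hasDerivAt_add_line x (EuclideanSpace.single α 1) 0
  simpa [torusMk_single, torusMk_zero] using this

theorem pd_mul (hφ : SmoothOnTorus φ) (hψ : SmoothOnTorus ψ) (α : Fin 3) (x : T3) :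
    pd α (fun x => φ x * ψ x) x = pd α φ x * ψ x + φ x * pd α ψ x := by
  have := ((hφ.hasDerivAt_pd α x).mul (hψ.hasDerivAt_pd α x)).deriv
  simpa [pd, Pi.mul_def] using this

theorem pd_neg (hφ : SmoothOnTorus φ) (α : Fin 3) (x : T3) :
    pd α (fun x => -φ x) x = -pd α φ x :=
  (hφ.hasDerivAt_pd α x).neg.deriv

theorem pd_add_right (φ : T3 → ℝ) (a : T3) (α : Fin 3) (x : T3) :
    pd α (fun x => φ (x + a)) x = pd α φ (x + a) := by
  simp only [pd]; congr 1; ext s; congr 1; abel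

theorem pd_comm (hφ : SmoothOnTorus φ) (α β : Fin 3) : pd α (pd β φ) = pd β (pd α φ) := by
  funext x
  obtain ⟨x, rfl⟩ := torusMk_surjective x
  have key : ∀ α β : Fin 3, pd α (pd β φ) (torusMk x) =
      fderiv ℝ (fderiv ℝ (φ ∘ torusMk)) x (EuclideanSpace.single α 1)
        (EuclideanSpace.single β 1) := by
    intro α β
    rw [(hφ.pd β).pd_torusMk]
    have h1 : pd β φ ∘ torusMk =
        fun x => fderiv ℝ (φ ∘ torusMk) x (EuclideanSpace.single β 1) :=
      funext fun x => hφ.pd_torusMk β x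
    rw [h1]
    have h2 : DifferentiableAt ℝ (fderiv ℝ (φ ∘ torusMk)) x :=
      ((smoothOnTorus_iff.1 hφ).fderiv_right (m := ∞) (by simp)).differentiable (by simp) x
    rw [fderiv_clm_apply h2 (differentiableAt_const _)]
    simp
  rw [key, key]
  have h3 : IsSymmSndFDerivAt ℝ (φ ∘ torusMk) x :=
    (smoothOnTorus_iff.1 hφ).contDiffAt.isSymmSndFDerivAt
      (by simpa using WithTop.coe_le_coe.2 (le_top : (2 : ℕ∞) ≤ ⊤))
  exact h3 _ _

protected theorem integrable (hφ : SmoothOnTorus φ) : Integrable φ volume :=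
  hφ.continuous.integrable_of_hasCompactSupport (HasCompactSupport.of_compactSpace _)

theorem exists_bound (hφ : SmoothOnTorus φ) : ∃ K, 0 ≤ K ∧ ∀ x, |φ x| ≤ K := by
  obtain ⟨K, hK⟩ := isCompact_univ.exists_bound_of_continuousOn hφ.continuous.continuousOn
  exact ⟨K, (abs_nonneg _).trans (hK 0 trivial), fun x => hK x trivial⟩

/-- Along a full period in direction `α` the function returns to its initial value, so each such
line integral of `∂_αφ` vanishes. Integrating over the starting point and exchanging the integrals,
translation invariance makes every parameter `s` contribute `∫ ∂_αφ`. -/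
theorem integral_pd (hφ : SmoothOnTorus φ) (α : Fin 3) : ∫ x, pd α φ x = 0 := by
  have h0 : ∀ x : T3, ∫ s in (0 : ℝ)..1, pd α φ (x + Pi.single α (s : UnitAddCircle)) = 0 := by
    intro x
    have := hφ.sub_eq_integral x (EuclideanSpace.single α 1)
    have h1 := torusMk_single α 1
    rw [one_smul, AddCircle.coe_period] at h1
    simp only [torusMk_single, h1] at this
    simpa using this.symm
  have hc : Continuous fun z : T3 × ℝ => pd α φ (z.1 + Pi.single α (z.2 : UnitAddCircle)) := by
    refine (hφ.pd α).continuous.comp (continuous_fst.add ?_)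
    exact (continuous_single α).comp ((AddCircle.continuous_mk' 1).comp continuous_snd)
  obtain ⟨K, -, hK⟩ := (hφ.pd α).exists_bound
  have hi : Integrable (Function.uncurry fun (x : T3) (s : ℝ) =>
      pd α φ (x + Pi.single α (s : UnitAddCircle)))
      (volume.prod (volume.restrict (Set.Ioc (0 : ℝ) 1))) :=
    Integrable.of_bound hc.aestronglyMeasurable K (ae_of_all _ fun z => hK _)
  have hs := integral_integral_swap hi
  simp_rw [intervalIntegral.integral_of_le zero_le_one] at h0
  simp_rw [h0] at hs
  have h2 : ∀ a : T3, ∫ x, pd α φ (x + a) = ∫ x, pd α φ x := fun a =>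
    integral_add_right_eq_self _ a
  simp_rw [h2] at hs
  simpa using hs.symm

end SmoothOnTorus

open UnitAddTorus Filter Topology ComplexConjugate

/-! ### Fourier monomials as test functions -/

theorem mFourier_add_single (n : Fin 3 → ℤ) (x : T3) (α : Fin 3) (s : ℝ) :
    mFourier n (x + Pi.single α (s : UnitAddCircle))
      = mFourier n x * Complex.exp (2 * Real.pi * Complex.I * n α * s) := by
  have h1 : mFourier n (x + Pi.single α (s : UnitAddCircle))
      = mFourier n x * mFourier n (Pi.single α (s : UnitAddCircle)) := by
    simp only [mFourier, ContinuousMap.coe_mk, Pi.add_apply, ← Finset.prod_mul_distrib]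
    refine Finset.prod_congr rfl fun i _ => ?_
    simp [fourier_apply, AddCircle.toCircle_add]
  have h2 : mFourier n (Pi.single α (s : UnitAddCircle)) = fourier (n α) (s : UnitAddCircle) := by
    simp only [mFourier, ContinuousMap.coe_mk]
    rw [Finset.prod_eq_single α]
    · simp
    · intro i _ hi; simp [hi]
    · simp
  rw [h1, h2, fourier_coe_apply]
  simp

theorem mFourier_torusMk (n : Fin 3 → ℤ) (x : V3) :
    mFourier n (torusMk x) = Complex.exp (∑ i, 2 * Real.pi * Complex.I * n i * x i) := by
  simp only [mFourier, ContinuousMap.coe_mk, torusMk, Complex.exp_sum]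
  refine Finset.prod_congr rfl fun i _ => ?_
  rw [fourier_coe_apply]; simp

theorem contDiff_mFourier (n : Fin 3 → ℤ) : ContDiff ℝ ∞ fun x => mFourier n (torusMk x) := by
  simp_rw [mFourier_torusMk]
  refine ContDiff.cexp (ContDiff.sum fun i _ => contDiff_const.mul ?_)
  exact Complex.ofRealCLM.contDiff.comp
    (EuclideanSpace.proj (𝕜 := ℝ) i : V3 →L[ℝ] ℝ).contDiff

theorem smoothOnTorus_mFourier_re (n : Fin 3 → ℤ) : SmoothOnTorus fun x => (mFourier n x).re :=
  Complex.reCLM.contDiff.comp (contDiff_mFourier n)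

theorem smoothOnTorus_mFourier_im (n : Fin 3 → ℤ) : SmoothOnTorus fun x => (mFourier n x).im :=
  Complex.imCLM.contDiff.comp (contDiff_mFourier n)

theorem hasDerivAt_mFourier (n : Fin 3 → ℤ) (α : Fin 3) (x : T3) :
    HasDerivAt (fun s : ℝ => mFourier n (x + Pi.single α (s : UnitAddCircle)))
      (mFourier n x * (2 * Real.pi * Complex.I * n α)) 0 := by
  simp_rw [mFourier_add_single]
  have h := ((Complex.ofRealCLM.hasDerivAt (x := (0 : ℝ))).const_mul
    (2 * Real.pi * Complex.I * n α)).cexp.const_mul (mFourier n x)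
  simpa using h

theorem pd_mFourier_re (n : Fin 3 → ℤ) (α : Fin 3) (x : T3) :
    pd α (fun x => (mFourier n x).re) x = -(2 * Real.pi * n α) * (mFourier n x).im := by
  have h := (Complex.reCLM.hasFDerivAt.comp_hasDerivAt (0 : ℝ) (hasDerivAt_mFourier n α x)).deriv
  have h2 : (mFourier n x * (2 * Real.pi * Complex.I * n α)).re
      = -(2 * Real.pi * n α) * (mFourier n x).im := by
    simp [Complex.mul_re, Complex.mul_im]; ring
  rw [← h2]; exact h

theorem pd_mFourier_im (n : Fin 3 → ℤ) (α : Fin 3) (x : T3) :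
    pd α (fun x => (mFourier n x).im) x = 2 * Real.pi * n α * (mFourier n x).re := by
  have h := (Complex.imCLM.hasFDerivAt.comp_hasDerivAt (0 : ℝ) (hasDerivAt_mFourier n α x)).deriv
  have h2 : (mFourier n x * (2 * Real.pi * Complex.I * n α)).im
      = 2 * Real.pi * n α * (mFourier n x).re := by
    simp [Complex.mul_re, Complex.mul_im]; ring
  rw [← h2]; exact h

theorem SmoothOnTorus.integrable_mul {f φ : T3 → ℝ} (hf : Integrable f volume)
    (hφ : SmoothOnTorus φ) : Integrable (fun x => f x * φ x) volume := by
  obtain ⟨K, -, hK⟩ := hφ.exists_bound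
  exact hf.mul_bdd hφ.continuous.aestronglyMeasurable (ae_of_all _ hK)

theorem integral_mul_mFourier {f : T3 → ℝ} (hf : Integrable f volume) (n : Fin 3 → ℤ) :
    ∫ x, (f x : ℂ) * mFourier n x
      = ((∫ x, f x * (mFourier n x).re : ℝ) : ℂ)
        + ((∫ x, f x * (mFourier n x).im : ℝ) : ℂ) * Complex.I := by
  have h1 := SmoothOnTorus.integrable_mul hf (smoothOnTorus_mFourier_re n)
  have h2 := SmoothOnTorus.integrable_mul hf (smoothOnTorus_mFourier_im n)
  rw [← integral_complex_ofReal, ← integral_complex_ofReal, ← integral_mul_const,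
    ← integral_add h1.ofReal (h2.ofReal.mul_const _)]
  refine integral_congr_ae (ae_of_all _ fun x => ?_)
  beta_reduce
  conv_lhs => rw [← Complex.re_add_im (mFourier n x)]
  push_cast; ring

/-! ### The fundamental lemma of the calculus of variations -/

/-- Integration against `f ∈ L¹` is a continuous functional on `C(𝕋³, ℂ)`. It kills the Fourier
monomials, whose real and imaginary parts are test functions, and these span a dense subspace. -/
theorem integral_mul_continuousMap_eq_zero {f : T3 → ℝ} (hf : Integrable f volume)
    (h : ∀ φ, SmoothOnTorus φ → ∫ x, f x * φ x = 0) (g : C(T3, ℂ)) :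
    ∫ x, (f x : ℂ) * g x = 0 := by
  have hint : ∀ g : C(T3, ℂ), Integrable (fun x => (f x : ℂ) * g x) volume := fun g =>
    hf.ofReal.mul_bdd (c := ‖g‖) g.continuous.aestronglyMeasurable
      (ae_of_all _ fun x => g.norm_coe_le_norm x)
  let L : C(T3, ℂ) →L[ℂ] ℂ := LinearMap.mkContinuous
    { toFun := fun g => ∫ x, (f x : ℂ) * g x
      map_add' := fun g k => by
        rw [← integral_add (hint g) (hint k)]; simp [mul_add]
      map_smul' := fun c g => by
        simp only [RingHom.id_apply, smul_eq_mul, ← integral_const_mul]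
        congr 1; ext x; simp; ring } (∫ x, |f x|) (fun g => by
        refine (norm_integral_le_integral_norm _).trans ?_
        rw [← integral_mul_const]
        refine integral_mono (hint g).norm (hf.abs.mul_const _) fun x => ?_
        simp only [norm_mul, Complex.norm_real, Real.norm_eq_abs]
        gcongr; exact g.norm_coe_le_norm x)
  have hspan : (⊤ : Submodule ℂ C(T3, ℂ)) ≤ LinearMap.ker (L : C(T3, ℂ) →ₗ[ℂ] ℂ) := by
    rw [← span_mFourier_closure_eq_top (d := Fin 3)]
    refine Submodule.topologicalClosure_minimal _ ?_ L.isClosed_ker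
    rw [Submodule.span_le]
    rintro _ ⟨n, rfl⟩
    change ∫ x, (f x : ℂ) * mFourier n x = 0
    rw [integral_mul_mFourier hf, h _ (smoothOnTorus_mFourier_re n),
      h _ (smoothOnTorus_mFourier_im n)]
    simp
  exact hspan (Submodule.mem_top (x := g))

/-- The indicator of a closed set is a bounded pointwise limit of continuous functions, so `f` has
integral zero over every closed set. -/
theorem ae_eq_zero_of_forall_smooth {f : T3 → ℝ} (hf : Integrable f volume)
    (h : ∀ φ, SmoothOnTorus φ → ∫ x, f x * φ x = 0) : f =ᵐ[volume] 0 := by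
  refine ae_eq_zero_of_forall_setIntegral_isClosed_eq_zero hf fun K hK => ?_
  have hδ : ∀ n : ℕ, (0 : ℝ) < 1 / ((n : ℝ) + 1) := fun n => by positivity
  have hc : ∀ n : ℕ, Continuous fun x => ((thickenedIndicator (hδ n) K x : NNReal) : ℝ) :=
    fun n => NNReal.continuous_coe.comp (thickenedIndicator (hδ n) K).continuous
  have hz : ∀ n : ℕ, ∫ x, f x * ((thickenedIndicator (hδ n) K x : NNReal) : ℝ) = 0 := by
    intro n
    have := integral_mul_continuousMap_eq_zero hf h
      ⟨fun x => (((thickenedIndicator (hδ n) K x : NNReal) : ℝ) : ℂ),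
        Complex.continuous_ofReal.comp (hc n)⟩
    simp only [ContinuousMap.coe_mk, ← Complex.ofReal_mul] at this
    rw [integral_complex_ofReal] at this
    exact_mod_cast this
  have hlim : Tendsto (fun n : ℕ => ∫ x, f x * ((thickenedIndicator (hδ n) K x : NNReal) : ℝ))
      atTop (𝓝 (∫ x, K.indicator f x)) := by
    refine tendsto_integral_of_dominated_convergence (fun x => |f x|) ?_ hf.abs ?_ ?_
    · exact fun n => hf.aestronglyMeasurable.mul (hc n).aestronglyMeasurable
    · refine fun n => ae_of_all _ fun x => ?_
      rw [norm_mul]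
      refine mul_le_of_le_one_right (norm_nonneg _) ?_
      simpa using thickenedIndicator_le_one (hδ n) K x
    · refine ae_of_all _ fun x => ?_
      have ht := thickenedIndicator_tendsto_indicator_closure hδ
        tendsto_one_div_add_atTop_nhds_zero_nat K
      rw [tendsto_pi_nhds] at ht
      have hx := (NNReal.continuous_coe.tendsto _).comp (ht x)
      have hx' := hx.const_mul (f x)
      refine hx'.congr' ?_ |>.trans_eq ?_
      · rfl
      · rw [hK.closure_eq]
        by_cases hxK : x ∈ K <;> simp [hxK]
  simp_rw [hz] at hlim
  rw [← integral_indicator hK.measurableSet]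
  exact tendsto_nhds_unique hlim tendsto_const_nhds

/-! ### Orthogonality of gradients and divergence-free fields -/

theorem volume_eq_pi_haar :
    (Measure.pi fun _ : Fin 3 => (AddCircle.haarAddCircle : Measure UnitAddCircle))
      = (volume : Measure T3) := by
  have : (volume : Measure UnitAddCircle) = AddCircle.haarAddCircle := by
    rw [AddCircle.volume_eq_smul_haarAddCircle]; simp
  rw [← this]; rfl

theorem hasSum_parseval {f g : T3 → ℂ} (hf : MemLp f 2 volume) (hg : MemLp g 2 volume) :
    HasSum (fun n : Fin 3 → ℤ => conj (∫ x, mFourier (-n) x * f x) * ∫ x, mFourier (-n) x * g x)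
      (∫ x, conj (f x) * g x) := by
  rw [← volume_eq_pi_haar] at hf hg ⊢
  have h := hasSum_prod_mFourierCoeff (hf.toLp f) (hg.toLp g)
  simp only [mFourierCoeff, smul_eq_mul] at h
  convert h using 1
  · ext n
    congr 1
    · congr 1
      refine integral_congr_ae ?_
      filter_upwards [hf.coeFn_toLp] with x hx
      rw [hx]
    · refine integral_congr_ae ?_
      filter_upwards [hg.coeFn_toLp] with x hx
      rw [hx]
  · refine integral_congr_ae ?_
    filter_upwards [hf.coeFn_toLp, hg.coeFn_toLp] with x hx hx'
    rw [hx, hx']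

/-- The `L²`-orthogonality of weak gradients and weakly divergence-free fields on the torus. -/
theorem integral_grad_mul_divFree {y : T3 → ℝ} {F H : Fin 3 → T3 → ℝ}
    (hy : Integrable y volume) (hF : ∀ γ, MemLp (F γ) 2 volume) (hH : ∀ γ, MemLp (H γ) 2 volume)
    (hgrad : ∀ γ φ, SmoothOnTorus φ → ∫ x, F γ x * φ x = -∫ x, y x * pd γ φ x)
    (hdiv : ∀ φ, SmoothOnTorus φ → ∑ γ, ∫ x, H γ x * pd γ φ x = 0) :
    ∑ γ, ∫ x, F γ x * H γ x = 0 := by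
  have hFi : ∀ γ, Integrable (F γ) volume := fun γ => (hF γ).integrable one_le_two
  have hHi : ∀ γ, Integrable (H γ) volume := fun γ => (hH γ).integrable one_le_two
  -- The Fourier coefficient of a gradient is parallel to the frequency `n`; that of a
  -- divergence-free field (next) is orthogonal to it. Every term of the Parseval sum therefore
  -- vanishes. Only `y ∈ L¹` is needed.
  have hFn : ∀ γ (n : Fin 3 → ℤ), ∫ x, mFourier n x * (F γ x : ℂ)
      = n γ * (-(2 * Real.pi * Complex.I) * ∫ x, (y x : ℂ) * mFourier n x) := by
    intro γ n
    simp_rw [mul_comm (mFourier n _)]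
    rw [integral_mul_mFourier (hFi γ), integral_mul_mFourier hy,
      hgrad γ _ (smoothOnTorus_mFourier_re n), hgrad γ _ (smoothOnTorus_mFourier_im n)]
    simp_rw [pd_mFourier_re, pd_mFourier_im]
    have e1 : ∫ x, y x * (-(2 * Real.pi * n γ) * (mFourier n x).im)
        = -(2 * Real.pi * n γ) * ∫ x, y x * (mFourier n x).im := by
      rw [← integral_const_mul]; congr 1; ext x; ring
    have e2 : ∫ x, y x * (2 * Real.pi * n γ * (mFourier n x).re)
        = (2 * Real.pi * n γ) * ∫ x, y x * (mFourier n x).re := by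
      rw [← integral_const_mul]; congr 1; ext x; ring
    rw [e1, e2]
    push_cast
    linear_combination ((2 * (Real.pi : ℂ) * n γ) *
      ((∫ x, y x * (mFourier n x).im : ℝ) : ℂ)) * Complex.I_mul_I
  have hHn : ∀ n : Fin 3 → ℤ, ∑ γ, (n γ : ℂ) * ∫ x, mFourier n x * (H γ x : ℂ) = 0 := by
    intro n
    have h1 := hdiv _ (smoothOnTorus_mFourier_re n)
    have h2 := hdiv _ (smoothOnTorus_mFourier_im n)
    simp_rw [pd_mFourier_re] at h1
    simp_rw [pd_mFourier_im] at h2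
    have e1 : ∀ γ, ∫ x, H γ x * (-(2 * Real.pi * n γ) * (mFourier n x).im)
        = -(2 * Real.pi) * (n γ * ∫ x, H γ x * (mFourier n x).im) := by
      intro γ; rw [← mul_assoc, ← integral_const_mul]; congr 1; ext x; ring
    have e2 : ∀ γ, ∫ x, H γ x * (2 * Real.pi * n γ * (mFourier n x).re)
        = (2 * Real.pi) * (n γ * ∫ x, H γ x * (mFourier n x).re) := by
      intro γ; rw [← mul_assoc, ← integral_const_mul]; congr 1; ext x; ring
    simp_rw [e1, ← Finset.mul_sum] at h1
    simp_rw [e2, ← Finset.mul_sum] at h2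
    have h1' := (mul_eq_zero.1 h1).resolve_left (by simp [Real.pi_ne_zero])
    have h2' := (mul_eq_zero.1 h2).resolve_left (by simp [Real.pi_ne_zero])
    simp_rw [mul_comm (mFourier n _)]
    simp_rw [integral_mul_mFourier (hHi _), mul_add, Finset.sum_add_distrib, ← mul_assoc,
      ← Finset.sum_mul]
    have c1 : ((∑ γ, n γ * ∫ x, H γ x * (mFourier n x).im : ℝ) : ℂ) = 0 := by rw [h1']; simp
    have c2 : ((∑ γ, n γ * ∫ x, H γ x * (mFourier n x).re : ℝ) : ℂ) = 0 := by rw [h2']; simp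
    push_cast at c1 c2
    rw [c1, c2]; simp
  have hsum : HasSum (fun n : Fin 3 → ℤ => ∑ γ, conj (∫ x, mFourier (-n) x * (F γ x : ℂ)) *
      ∫ x, mFourier (-n) x * (H γ x : ℂ)) (∑ γ, ∫ x, conj (F γ x : ℂ) * (H γ x : ℂ)) :=
    hasSum_sum fun γ _ => hasSum_parseval (hF γ).ofReal (hH γ).ofReal
  have hzero : ∀ n : Fin 3 → ℤ, ∑ γ, conj (∫ x, mFourier (-n) x * (F γ x : ℂ)) *
      ∫ x, mFourier (-n) x * (H γ x : ℂ) = 0 := by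
    intro n
    have := hHn (-n)
    simp_rw [hFn, map_mul]
    have h3 : ∀ γ, conj ((((-n) γ : ℤ) : ℂ)) = (((-n) γ : ℤ) : ℂ) := fun γ => by simp
    simp_rw [h3]
    rw [← mul_zero (conj (-(2 * Real.pi * Complex.I)) * conj (∫ x, (y x : ℂ) * mFourier (-n) x)),
      ← this, Finset.mul_sum]
    refine Finset.sum_congr rfl fun γ _ => ?_
    ring
  simp_rw [hzero] at hsum
  have h0 := hsum.unique hasSum_zero
  simp_rw [Complex.conj_ofReal, ← Complex.ofReal_mul, integral_complex_ofReal] at h0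
  exact_mod_cast h0

/-! ### Averages of translates -/

/-- The marginal of an `L^p` function over a probability space is in `L^p`. -/
theorem memLp_integral_left {Ω X : Type*} [MeasurableSpace Ω] [MeasurableSpace X] {P : Measure Ω}
    [IsProbabilityMeasure P] {μ : Measure X} [SFinite μ] {p : ENNReal} (hp1 : 1 ≤ p) (hp : p ≠ ⊤)
    {G : Ω × X → ℝ} (hG : MemLp G p (P.prod μ)) : MemLp (fun x => ∫ o, G (o, x) ∂P) p μ := by
  have hp0 : p ≠ 0 := (zero_lt_one.trans_le hp1).ne'
  have hswap : AEStronglyMeasurable (fun z : X × Ω => G (z.2, z.1)) (μ.prod P) :=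
    hG.1.prod_swap
  refine ⟨hswap.integral_prod_right', ?_⟩
  have hfin := (eLpNorm_lt_top_iff_lintegral_rpow_enorm_lt_top hp0 hp).1 hG.2
  refine (eLpNorm_lt_top_iff_lintegral_rpow_enorm_lt_top hp0 hp).2 (lt_of_le_of_lt ?_ hfin)
  rw [lintegral_prod_symm _ (hG.1.enorm.pow_const _)]
  refine lintegral_mono_ae ?_
  filter_upwards [hswap.prodMk_left] with x hx
  -- On a probability space the `L¹` norm is at most the `L^p` norm.
  have h1 : ‖∫ o, G (o, x) ∂P‖ₑ ≤ eLpNorm (fun o => G (o, x)) p P := by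
    refine (enorm_integral_le_lintegral_enorm _).trans ?_
    rw [← eLpNorm_one_eq_lintegral_enorm]
    exact eLpNorm_le_eLpNorm_of_exponent_le hp1 hx
  refine (ENNReal.rpow_le_rpow h1 ENNReal.toReal_nonneg).trans ?_
  rw [eLpNorm_eq_lintegral_rpow_enorm_toReal hp0 hp, ← ENNReal.rpow_mul, one_div,
    inv_mul_cancel₀ (ENNReal.toReal_pos hp0 hp).ne', ENNReal.rpow_one]

section Averages

variable {Ω : Type*} [MeasurableSpace Ω] {P : Measure Ω} [IsProbabilityMeasure P]
  {g : Ω → T3} {m : Ω → ℝ} {f : T3 → ℝ}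

theorem measurePreserving_translate (hg : Measurable g) :
    MeasurePreserving (fun z : Ω × T3 => z.2 + g z.1) (P.prod volume) volume := by
  have h1 : MeasurePreserving (fun z : Ω × T3 => (id z.1, z.2 + g z.1))
      (P.prod volume) (P.prod volume) := by
    refine (MeasurePreserving.id P).skew_product (g := fun o x => x + g o)
      (measurable_snd.add (hg.comp measurable_fst)) (ae_of_all _ fun o => ?_)
    exact map_add_right_eq_self volume (g o)
  exact measurePreserving_snd.comp h1

theorem memLp_translate {p : ENNReal} (hg : Measurable g) (hm : Measurable m)
    (hm1 : ∀ o, |m o| ≤ 1) (hf : MemLp f p volume) :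
    MemLp (fun z : Ω × T3 => m z.1 * f (z.2 + g z.1)) p (P.prod volume) := by
  have h1 := hf.comp_measurePreserving (measurePreserving_translate (P := P) hg)
  refine h1.of_le ((hm.comp measurable_fst).aestronglyMeasurable.mul h1.1)
    (ae_of_all _ fun z => ?_)
  rw [norm_mul]
  exact mul_le_of_le_one_left (norm_nonneg _) (hm1 _)

theorem memLp_average {p : ENNReal} (hp1 : 1 ≤ p) (hp : p ≠ ⊤) (hg : Measurable g)
    (hm : Measurable m) (hm1 : ∀ o, |m o| ≤ 1) (hf : MemLp f p volume) :
    MemLp (fun x => ∫ o, m o * f (x + g o) ∂P) p volume :=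
  memLp_integral_left hp1 hp (memLp_translate hg hm hm1 hf)

/-- Fubini and translation invariance move the shift from `f`, which is merely integrable, to the
smooth factor. -/
theorem integral_average_mul (hg : Measurable g) (hm : Measurable m) (hm1 : ∀ o, |m o| ≤ 1)
    (hf : Integrable f volume) {φ : T3 → ℝ} (hφ : SmoothOnTorus φ) :
    ∫ x, (∫ o, m o * f (x + g o) ∂P) * φ x = ∫ o, m o * ∫ x, f x * φ (x - g o) ∂volume ∂P := by
  have hi := (memLp_one_iff_integrable.1
    (memLp_translate (P := P) hg hm hm1 (memLp_one_iff_integrable.2 hf)))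
  obtain ⟨K, -, hK⟩ := hφ.exists_bound
  have hi2 : Integrable (fun z : Ω × T3 => m z.1 * f (z.2 + g z.1) * φ z.2) (P.prod volume) :=
    hi.mul_bdd (hφ.continuous.measurable.comp measurable_snd).aestronglyMeasurable
      (ae_of_all _ fun z => hK z.2)
  have hs := integral_integral_swap (f := fun o x => m o * f (x + g o) * φ x) hi2
  simp_rw [← integral_mul_const]
  rw [← hs]
  refine integral_congr_ae (ae_of_all _ fun o => ?_)
  beta_reduce
  rw [← integral_const_mul,
    ← integral_add_right_eq_self (fun x => m o * (f x * φ (x - g o))) (g o)]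
  simp [mul_assoc]

end Averages

/-! ### A measurable section of the projection onto the torus -/

/-- The representative in `(0, 1]³` of a point of the torus. -/
def torusLift (t : T3) : V3 := WithLp.toLp 2 fun i => (AddCircle.equivIoc 1 0 (t i) : ℝ)

theorem torusMk_torusLift (t : T3) : torusMk (torusLift t) = t := by
  ext i; simp [torusMk, torusLift, AddCircle.coe_equivIoc]

theorem abs_torusLift_le (t : T3) (i : Fin 3) : |torusLift t i| ≤ 1 := by
  have h := (AddCircle.equivIoc (1 : ℝ) 0 (t i)).2
  simp only [torusLift]
  rw [abs_of_pos h.1]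
  simpa using h.2

theorem measurable_torusLift : Measurable torusLift := by
  have h : ∀ i, Measurable fun t : T3 => (AddCircle.equivIoc (1 : ℝ) 0 (t i) : ℝ) := fun i =>
    measurable_subtype_coe.comp
      ((AddCircle.measurableEquivIoc (1 : ℝ) 0).measurable.comp (measurable_pi_apply i))
  exact (WithLp.measurable_toLp 2 _).comp (measurable_pi_lambda _ h)

/-! ### Potentials of curl-free fields -/

/-- The probability measure on the parameters `(t, s) ∈ 𝕋³ × (0, 1]`. -/
def segMeasure : Measure (T3 × ℝ) :=
  (volume : Measure T3).prod (volume.restrict (Set.Ioc (0 : ℝ) 1))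

instance : IsProbabilityMeasure (volume.restrict (Set.Ioc (0 : ℝ) 1)) :=
  ⟨by simp⟩

instance : IsProbabilityMeasure segMeasure := by unfold segMeasure; infer_instance

/-- The point `s t` of the segment from `0` to the representative of `t`. -/
def segPoint (z : T3 × ℝ) : T3 := torusMk (z.2 • torusLift z.1)

theorem measurable_segPoint : Measurable segPoint :=
  continuous_torusMk.measurable.comp
    (measurable_snd.smul (measurable_torusLift.comp measurable_fst))

theorem measurable_torusLift_apply (β : Fin 3) :
    Measurable fun z : T3 × ℝ => torusLift z.1 β :=
  ((EuclideanSpace.proj β : V3 →L[ℝ] ℝ).continuous.measurable.comp measurable_torusLift).comp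
    measurable_fst

/-- For fixed `t`, integrating the derivative of `φ` along the segment from `x` to `x - t` gives
`φ(x) - φ(x - t)`; averaging over `t` replaces the second term by the mean of `φ`. -/
theorem integral_segment_pd {φ : T3 → ℝ} (hφ : SmoothOnTorus φ) (x : T3) :
    ∫ z, ∑ β, torusLift z.1 β * pd β φ (x - segPoint z) ∂segMeasure
      = φ x - ∫ t, φ t := by
  have hint : Integrable (fun z => ∑ β, torusLift z.1 β * pd β φ (x - segPoint z)) segMeasure := by
    refine integrable_finsetSum _ fun β _ => ?_
    obtain ⟨K, hK0, hK⟩ := (hφ.pd β).exists_bound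
    refine Integrable.of_bound (C := 1 * K) ?_ (ae_of_all _ fun z => ?_)
    · exact ((measurable_torusLift_apply β).mul ((hφ.pd β).continuous.measurable.comp
        (measurable_const.sub measurable_segPoint))).aestronglyMeasurable
    · rw [norm_mul]
      exact mul_le_mul (abs_torusLift_le _ _) (hK _) (norm_nonneg _) zero_le_one
  unfold segMeasure at hint ⊢
  rw [integral_prod _ hint]
  have hinner : ∀ t : T3, ∫ s in Set.Ioc (0 : ℝ) 1,
      ∑ β, torusLift t β * pd β φ (x - segPoint (t, s)) = φ x - φ (x - t) := by
    intro t
    have h := hφ.sub_eq_integral x (-torusLift t)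
    rw [torusMk_neg, torusMk_torusLift, ← sub_eq_add_neg] at h
    rw [← neg_sub, h, ← intervalIntegral.integral_of_le zero_le_one,
      ← intervalIntegral.integral_neg]
    refine intervalIntegral.integral_congr fun s _ => ?_
    simp [segPoint, torusMk_neg, sub_eq_add_neg]
  simp only [hinner]
  have h1 : Integrable (fun t => φ (x - t)) volume :=
    hφ.integrable.comp_sub_left x
  rw [integral_sub (integrable_const _) h1, integral_sub_left_eq_self φ volume x]
  simp

/-- A curl-free `L^p` field of mean zero on the torus has a potential in `L^p`. -/
theorem exists_potential {p : ENNReal} (hp1 : 1 ≤ p) (hp : p ≠ ⊤) {F : T3 → M3}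
    (hF : MemLp F p volume) (hcurl : CurlFree F) (hmean : ∀ a, ∫ x, F x a = 0) :
    ∃ y : T3 → V3, MemLp y p volume ∧ HasWeakGradient y F := by
  have hFa : ∀ a, MemLp (fun x => F x a) p volume := fun a => hF.eval_piLp a
  have hFi : ∀ a, Integrable (fun x => F x a) volume := fun a => (hFa a).integrable hp1
  -- If `F = ∇y`, then `y(x + t) - y(x) = ∫₀¹ t · F(x + s t) ds`. Averaging over `t` gives `mean y -
  -- y(x) = ∑_β A i β x`, which suggests the potential `-∑_β A i β`.
  let A : Fin 3 → Fin 3 → T3 → ℝ := fun i β x =>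
    ∫ z, torusLift z.1 β * F (x + segPoint z) (i, β) ∂segMeasure
  have hA : ∀ i β, MemLp (A i β) p volume := fun i β =>
    memLp_average hp1 hp measurable_segPoint (measurable_torusLift_apply β)
      (fun z => abs_torusLift_le _ _) (hFa (i, β))
  have hy : ∀ i, MemLp (fun x => -∑ β, A i β x) p volume := fun i =>
    (memLp_finsetSum _ fun β _ => hA i β).neg
  refine ⟨fun x => WithLp.toLp 2 fun i => -∑ β, A i β x, MemLp.of_eval_piLp hy, ?_⟩
  intro i α φ hφ
  have hAi : ∀ β, Integrable (fun x => A i β x * pd α φ x) volume := fun β =>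
    SmoothOnTorus.integrable_mul ((hA i β).integrable hp1) (hφ.pd α)
  have hsub : ∀ z : T3 × ℝ, SmoothOnTorus fun x => φ (x - segPoint z) := fun z => by
    simpa [sub_eq_add_neg] using hφ.comp_add_right (-segPoint z)
  have hpd : ∀ (z : T3 × ℝ) (γ : Fin 3) (x : T3),
      pd γ (fun x => φ (x - segPoint z)) x = pd γ φ (x - segPoint z) := fun z γ x => by
    simpa [sub_eq_add_neg] using SmoothOnTorus.pd_add_right φ (-segPoint z) γ x
  -- the field `F` paired with the derivatives of the translates of `φ`
  have hjoint : ∀ β, Integrable (fun w : (T3 × ℝ) × T3 => torusLift w.1.1 β *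
      (F w.2 (i, α) * pd β φ (w.2 - segPoint w.1))) (segMeasure.prod volume) := by
    intro β
    obtain ⟨K, hK0, hK⟩ := (hφ.pd β).exists_bound
    have h1 : Integrable (fun w : (T3 × ℝ) × T3 => F w.2 (i, α)) (segMeasure.prod volume) :=
      measurePreserving_snd.integrable_comp_of_integrable (hFi (i, α))
    have h2 : Measurable fun w : (T3 × ℝ) × T3 => pd β φ (w.2 - segPoint w.1) :=
      (hφ.pd β).continuous.measurable.comp
        (measurable_snd.sub (measurable_segPoint.comp measurable_fst))
    have h3 := h1.mul_bdd (c := K) h2.aestronglyMeasurable (ae_of_all _ fun w => hK _)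
    exact h3.bdd_mul (c := 1)
      ((measurable_torusLift_apply β).comp measurable_fst).aestronglyMeasurable
      (ae_of_all _ fun w => abs_torusLift_le _ _)
  -- After the translation is moved to `φ`, the curl condition exchanges `α` and `β`. The derivative
  -- is now taken in the direction of the segment and can be integrated along it.
  have hkey : ∀ β, ∫ x, A i β x * pd α φ x
      = ∫ x, ∫ z, torusLift z.1 β * (F x (i, α) * pd β φ (x - segPoint z)) ∂segMeasure := by
    intro β
    rw [integral_average_mul measurable_segPoint (measurable_torusLift_apply β)
      (fun z => abs_torusLift_le _ _) (hFi (i, β)) (hφ.pd α)]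
    rw [← integral_integral_swap (f := fun z x => torusLift z.1 β *
      (F x (i, α) * pd β φ (x - segPoint z))) (hjoint β)]
    refine integral_congr_ae (ae_of_all _ fun z => ?_)
    beta_reduce
    rw [integral_const_mul]
    have := hcurl i α β _ (hsub z)
    simp only [hpd] at this
    rw [this]
  have hsum : ∑ β, ∫ x, A i β x * pd α φ x
      = ∫ x, F x (i, α) * (φ x - ∫ t, φ t) := by
    simp_rw [hkey]
    rw [← integral_finsetSum _ fun β _ => (hjoint β).integral_prod_right]
    have hae : ∀ᵐ x : T3, ∀ β, Integrable (fun z : T3 × ℝ => torusLift z.1 β *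
        (F x (i, α) * pd β φ (x - segPoint z))) segMeasure :=
      ae_all_iff.2 fun β => (hjoint β).prod_left_ae
    refine integral_congr_ae ?_
    filter_upwards [hae] with x hx
    rw [← integral_finsetSum _ fun β _ => hx β, ← integral_segment_pd hφ x,
      ← integral_const_mul]
    refine integral_congr_ae (ae_of_all _ fun z => ?_)
    simp only [Finset.mul_sum]
    exact Finset.sum_congr rfl fun β _ => by ring
  -- The mean of `φ` left over from the averaging is multiplied by the mean of `F`, which is zero.
  have hmain : ∫ x, F x (i, α) * φ x = ∑ β, ∫ x, A i β x * pd α φ x := by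
    rw [hsum]
    simp_rw [mul_sub]
    rw [integral_sub (SmoothOnTorus.integrable_mul (hFi _) hφ) ((hFi _).mul_const _),
      integral_mul_const, hmean]
    simp
  rw [hmain, ← integral_finsetSum _ fun β _ => hAi β, ← integral_neg]
  refine integral_congr_ae (ae_of_all _ fun x => ?_)
  simp [Finset.sum_mul]

/-! ### The derivatives of the null Lagrangians -/

/-- Indices are taken modulo 3: the cyclic order absorbs the cofactor signs, so later arguments need
no case distinction by sign. -/
theorem cof_apply (F : M3) (j β : Fin 3) :
    cof F (j, β) = F (j + 1, β + 1) * F (j + 2, β + 2) - F (j + 1, β + 2) * F (j + 2, β + 1) := by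
  simp only [cof, Matrix.adjugate_fin_three, toMat]
  fin_cases j <;> fin_cases β <;> simp <;> ring

theorem det_toMat (F : M3) : (toMat F).det =
    F (0, 0) * F (1, 1) * F (2, 2) - F (0, 0) * F (1, 2) * F (2, 1)
      - F (0, 1) * F (1, 0) * F (2, 2) + F (0, 1) * F (1, 2) * F (2, 0)
      + F (0, 2) * F (1, 0) * F (2, 1) - F (0, 2) * F (1, 1) * F (2, 0) := by
  rw [Matrix.det_fin_three]; rfl

theorem hasFDerivAt_entry (F : M3) (a : Fin 3 × Fin 3) :
    HasFDerivAt (fun G : M3 => G a) (EuclideanSpace.proj a : M3 →L[ℝ] ℝ) F :=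
  (EuclideanSpace.proj a : M3 →L[ℝ] ℝ).hasFDerivAt

theorem dPhi_inl (a : Fin 3 × Fin 3) (i α : Fin 3) (F : M3) :
    dPhi (Sum.inl a) i α F = if a = (i, α) then 1 else 0 := by
  simp only [dPhi, comp, Phi]
  rw [(hasFDerivAt_entry F a).fderiv]
  simp

theorem dPhi_cof (j β i α : Fin 3) (F : M3) :
    dPhi (Sum.inr (Sum.inl (j, β))) i α F =
      (F (j + 1, β + 1) * (if (j + 2, β + 2) = (i, α) then 1 else 0)
        + (if (j + 1, β + 1) = (i, α) then 1 else 0) * F (j + 2, β + 2))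
      - (F (j + 1, β + 2) * (if (j + 2, β + 1) = (i, α) then 1 else 0)
        + (if (j + 1, β + 2) = (i, α) then 1 else 0) * F (j + 2, β + 1)) := by
  simp only [dPhi, comp, Phi, cof_apply]
  have h := fun a => hasFDerivAt_entry F a
  rw [(((h (j + 1, β + 1)).fun_mul (h (j + 2, β + 2))).fun_sub
    ((h (j + 1, β + 2)).fun_mul (h (j + 2, β + 1)))).fderiv]
  simp

theorem dPhi_det (i α : Fin 3) (F : M3) :
    dPhi (Sum.inr (Sum.inr ())) i α F = cof F (i, α) := by
  simp only [dPhi, comp, Phi, det_toMat, cof_apply]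
  have h := fun a => hasFDerivAt_entry F a
  have t := fun a b c => ((h a).fun_mul (h b)).fun_mul (h c)
  rw [((((((t (0, 0) (1, 1) (2, 2)).fun_sub (t (0, 0) (1, 2) (2, 1))).fun_sub
    (t (0, 1) (1, 0) (2, 2))).fun_add (t (0, 1) (1, 2) (2, 0))).fun_add
    (t (0, 2) (1, 0) (2, 1))).fun_sub (t (0, 2) (1, 1) (2, 0))).fderiv]
  fin_cases i <;> fin_cases α <;> simp <;> ring

theorem continuous_entry (a : Fin 3 × Fin 3) : Continuous fun F : M3 => F a :=
  (EuclideanSpace.proj a : M3 →L[ℝ] ℝ).continuous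

theorem continuous_dPhi (B : Idx) (i α : Fin 3) : Continuous (dPhi B i α) := by
  rcases B with a | ⟨j, β⟩ | _
  · rw [show dPhi (Sum.inl a) i α = fun _ => _ from funext (dPhi_inl a i α)]
    exact continuous_const
  · rw [show dPhi (Sum.inr (Sum.inl (j, β))) i α = fun F => _ from funext (dPhi_cof j β i α)]
    have := continuous_entry
    exact (((this _).mul continuous_const).add (continuous_const.mul (this _))).sub
      (((this _).mul continuous_const).add (continuous_const.mul (this _)))
  · rw [show dPhi (Sum.inr (Sum.inr ())) i α = fun F => _ from funext (dPhi_det i α)]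
    simp_rw [cof_apply]
    have := continuous_entry
    exact ((this _).mul (this _)).sub ((this _).mul (this _))

theorem abs_dPhi_inl_le (a : Fin 3 × Fin 3) (i α : Fin 3) (F : M3) :
    |dPhi (Sum.inl a) i α F| ≤ 1 := by
  rw [dPhi_inl]; split_ifs <;> simp

theorem abs_entry_le (F : M3) (a : Fin 3 × Fin 3) : |F a| ≤ ‖F‖ := PiLp.norm_apply_le F a

theorem abs_dPhi_cof_le (a : Fin 3 × Fin 3) (i α : Fin 3) (F : M3) :
    |dPhi (Sum.inr (Sum.inl a)) i α F| ≤ 4 * ‖F‖ := by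
  obtain ⟨j, β⟩ := a
  rw [dPhi_cof]
  have hite : ∀ (P : Prop) [Decidable P] (a : Fin 3 × Fin 3),
      |F a * (if P then 1 else 0)| ≤ ‖F‖ := by
    intro P _ a
    split_ifs <;> simp [abs_entry_le]
  have h2 : ∀ (P : Prop) [Decidable P] (a : Fin 3 × Fin 3),
      |(if P then 1 else 0) * F a| ≤ ‖F‖ := by
    intro P _ a; rw [mul_comm]; exact hite P a
  refine (abs_sub _ _).trans ?_
  refine (add_le_add (abs_add_le _ _) (abs_add_le _ _)).trans ?_
  linarith [hite ((j + 2, β + 2) = (i, α)) (j + 1, β + 1), h2 ((j + 1, β + 1) = (i, α))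
    (j + 2, β + 2), hite ((j + 2, β + 1) = (i, α)) (j + 1, β + 2),
    h2 ((j + 1, β + 2) = (i, α)) (j + 2, β + 1)]

theorem abs_dPhi_det_le (u : Unit) (i α : Fin 3) (F : M3) :
    |dPhi (Sum.inr (Sum.inr u)) i α F| ≤ 2 * ‖F‖ ^ 2 := by
  rw [show u = () from rfl, dPhi_det, cof_apply]
  refine (abs_sub _ _).trans ?_
  rw [abs_mul, abs_mul]
  have h := fun a => abs_entry_le F a
  nlinarith [mul_le_mul (h (i + 1, α + 1)) (h (i + 2, α + 2)) (abs_nonneg _) (norm_nonneg F),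
    mul_le_mul (h (i + 1, α + 2)) (h (i + 2, α + 1)) (abs_nonneg _) (norm_nonneg F)]

/-! ### The weak Piola identity -/

theorem HasWeakGradient.curlFree {y : T3 → V3} {F : T3 → M3} (h : HasWeakGradient y F) :
    CurlFree F := by
  intro i α β φ hφ
  rw [h i β _ (hφ.pd α), h i α _ (hφ.pd β), hφ.pd_comm]

theorem memLp_mul_smooth {p : ENNReal} {f φ : T3 → ℝ} (hf : MemLp f p volume)
    (hφ : SmoothOnTorus φ) : MemLp (fun x => f x * φ x) p volume := by
  obtain ⟨K, -, hK⟩ := hφ.exists_bound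
  refine hf.of_le_mul (c := K) (hf.1.mul hφ.continuous.aestronglyMeasurable)
    (ae_of_all _ fun x => ?_)
  rw [norm_mul, mul_comm]
  exact mul_le_mul_of_nonneg_right (hK x) (norm_nonneg _)

/-- The cofactor is bilinear in the rows `j + 1` and `j + 2`. Differentiating in one row leaves the
other linearly, contracted with `∇χ` as a component of a curl, which vanishes weakly by the curl
condition. -/
theorem integral_dPhi_cof_pd {F : T3 → M3} (hF : ∀ a, Integrable (fun x => F x a) volume)
    (hc : CurlFree F) (j β i : Fin 3) {χ : T3 → ℝ} (hχ : SmoothOnTorus χ) :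
    ∫ x, ∑ α, dPhi (Sum.inr (Sum.inl (j, β))) i α (F x) * pd α χ x = 0 := by
  have hint : ∀ k γ δ, Integrable (fun x => F x (k, γ) * pd δ χ x) volume := fun k γ δ =>
    SmoothOnTorus.integrable_mul (hF _) (hχ.pd δ)
  have h1 : ∀ k, ∫ x, (F x (k, β + 1) * pd (β + 2) χ x - F x (k, β + 2) * pd (β + 1) χ x) = 0 := by
    intro k
    rw [integral_sub (hint _ _ _) (hint _ _ _), hc k (β + 2) (β + 1) χ hχ, sub_self]
  have h2 : ∀ x, ∑ α, dPhi (Sum.inr (Sum.inl (j, β))) i α (F x) * pd α χ x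
      = (if j + 2 = i then 1 else 0) *
          (F x (j + 1, β + 1) * pd (β + 2) χ x - F x (j + 1, β + 2) * pd (β + 1) χ x)
        - (if j + 1 = i then 1 else 0) *
          (F x (j + 2, β + 1) * pd (β + 2) χ x - F x (j + 2, β + 2) * pd (β + 1) χ x) := by
    intro x
    simp only [dPhi_cof, Prod.mk.injEq]
    clear h1 hint
    by_cases h1 : j + 1 = i <;> by_cases h2 : j + 2 = i <;> simp only [h1, h2] <;>
      fin_cases β <;> simp [Fin.sum_univ_three] <;> ring
  simp_rw [h2]
  have h3 : ∀ k, Integrable (fun x => F x (k, β + 1) * pd (β + 2) χ x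
      - F x (k, β + 2) * pd (β + 1) χ x) volume := fun k => (hint _ _ _).sub (hint _ _ _)
  rw [integral_sub ((h3 _).const_mul _) ((h3 _).const_mul _), integral_const_mul, integral_const_mul, h1, h1]
  simp

/-- Write `F_k` for the `k`-th row. The integrand is the triple product `(F_{i+1} × F_{i+2}) · ∇χ =
F_{i+2} · H` with `H = ∇χ × F_{i+1}`. As `F_{i+1}` is a gradient, `H = curl(χ F_{i+1})` is
divergence-free, and the orthogonality of gradients and divergence-free fields in `L²` applies. -/
theorem integral_dPhi_det_pd {y : T3 → V3} {F : T3 → M3}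
    (hy : ∀ i, Integrable (fun x => y x i) volume) (hF : ∀ a, MemLp (fun x => F x a) 2 volume)
    (hw : HasWeakGradient y F) (i : Fin 3) {χ : T3 → ℝ} (hχ : SmoothOnTorus χ) :
    ∫ x, ∑ α, dPhi (Sum.inr (Sum.inr ())) i α (F x) * pd α χ x = 0 := by
  let H : Fin 3 → T3 → ℝ := fun γ x =>
    F x (i + 1, γ + 2) * pd (γ + 1) χ x - F x (i + 1, γ + 1) * pd (γ + 2) χ x
  have hH : ∀ γ, MemLp (H γ) 2 volume := fun γ =>
    (memLp_mul_smooth (hF _) (hχ.pd _)).sub (memLp_mul_smooth (hF _) (hχ.pd _))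
  have hFH : ∀ γ, Integrable (fun x => F x (i + 2, γ) * H γ x) volume := fun γ =>
    (hF (i + 2, γ)).integrable_mul (hH γ)
  have hpt : ∀ x, ∑ α, dPhi (Sum.inr (Sum.inr ())) i α (F x) * pd α χ x
      = ∑ γ, F x (i + 2, γ) * H γ x := by
    intro x
    simp only [dPhi_det, cof_apply, H]
    simp [Fin.sum_univ_three]
    ring
  simp_rw [hpt]
  rw [integral_finsetSum _ fun γ _ => hFH γ]
  refine integral_grad_mul_divFree (y := fun x => y x (i + 2)) (hy _) (fun γ => hF (i + 2, γ)) hH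
    (fun γ φ hφ => hw (i + 2) γ φ hφ) fun ψ hψ => ?_
  have hFi : ∀ a, Integrable (fun x => F x a) volume := fun a => (hF a).integrable one_le_two
  have hmul : ∀ γ δ, SmoothOnTorus fun x => pd γ χ x * pd δ ψ x := fun γ δ =>
    (hχ.pd γ).mul (hψ.pd δ)
  -- To verify that `H` is divergence-free, the derivative in `F = ∇y` is moved onto the smooth
  -- factors. What remains is `y` times a sum that cancels by symmetry of second derivatives.
  have h1 : ∀ γ, ∫ x, H γ x * pd γ ψ x
      = -(∫ x, y x (i + 1) * pd (γ + 2) (fun x => pd (γ + 1) χ x * pd γ ψ x) x)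
        + ∫ x, y x (i + 1) * pd (γ + 1) (fun x => pd (γ + 2) χ x * pd γ ψ x) x := by
    intro γ
    have e : ∀ x, H γ x * pd γ ψ x = F x (i + 1, γ + 2) * (pd (γ + 1) χ x * pd γ ψ x)
        - F x (i + 1, γ + 1) * (pd (γ + 2) χ x * pd γ ψ x) := fun x => by simp only [H]; ring
    simp_rw [e]
    rw [integral_sub (SmoothOnTorus.integrable_mul (hFi _) (hmul _ _))
      (SmoothOnTorus.integrable_mul (hFi _) (hmul _ _)), hw _ _ _ (hmul _ _),
      hw _ _ _ (hmul _ _)]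
    ring
  have hyi : ∀ γ δ ε, Integrable
      (fun x => y x (i + 1) * pd ε (fun x => pd γ χ x * pd δ ψ x) x) volume := fun γ δ ε =>
    SmoothOnTorus.integrable_mul (hy _) ((hmul γ δ).pd ε)
  simp_rw [h1, ← integral_neg]
  have h2 : ∀ γ, (∫ x, -(y x (i + 1) * pd (γ + 2) (fun x => pd (γ + 1) χ x * pd γ ψ x) x))
        + ∫ x, y x (i + 1) * pd (γ + 1) (fun x => pd (γ + 2) χ x * pd γ ψ x) x
      = ∫ x, (-(y x (i + 1) * pd (γ + 2) (fun x => pd (γ + 1) χ x * pd γ ψ x) x)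
        + y x (i + 1) * pd (γ + 1) (fun x => pd (γ + 2) χ x * pd γ ψ x) x) := fun γ =>
    (integral_add (hyi _ _ _).neg (hyi _ _ _)).symm
  simp_rw [h2]
  have h3 : ∀ γ ∈ Finset.univ, Integrable (fun x =>
      -(y x (i + 1) * pd (γ + 2) (fun x => pd (γ + 1) χ x * pd γ ψ x) x)
        + y x (i + 1) * pd (γ + 1) (fun x => pd (γ + 2) χ x * pd γ ψ x) x) volume :=
    fun γ _ => (hyi _ _ _).neg.add (hyi _ _ _)
  rw [← integral_finsetSum _ h3, ← integral_zero T3 ℝ]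
  refine integral_congr_ae (ae_of_all _ fun x => ?_)
  simp only [SmoothOnTorus.pd_mul (hχ.pd _) (hψ.pd _)]
  simp only [Fin.sum_univ_three, Fin.isValue, zero_add, Fin.reduceAdd]
  rw [hχ.pd_comm 2 1, hχ.pd_comm 2 0, hχ.pd_comm 1 0, hψ.pd_comm 2 1, hψ.pd_comm 2 0,
    hψ.pd_comm 1 0]
  ring

/-- The null Lagrangian (Piola) identity `∂_α (∂Φ^B/∂F_{iα}(∇y)) = 0` in the sense of
distributions. -/
theorem integral_dPhi_pd {y : T3 → V3} {F : T3 → M3}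
    (hy : ∀ i, Integrable (fun x => y x i) volume) (hF : ∀ a, MemLp (fun x => F x a) 2 volume)
    (hw : HasWeakGradient y F) (B : Idx) (i : Fin 3) {χ : T3 → ℝ} (hχ : SmoothOnTorus χ) :
    ∫ x, ∑ α, dPhi B i α (F x) * pd α χ x = 0 := by
  rcases B with ⟨j, β⟩ | ⟨j, β⟩ | u
  · have : ∀ x, ∑ α, dPhi (Sum.inl (j, β)) i α (F x) * pd α χ x
        = (if j = i then 1 else 0) * pd β χ x := by
      intro x
      simp only [dPhi_inl, Prod.mk.injEq]
      by_cases h : j = i <;> simp [h]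
    simp_rw [this]
    rw [integral_const_mul, hχ.integral_pd, mul_zero]
  · exact integral_dPhi_cof_pd (fun a => (hF a).integrable one_le_two) hw.curlFree j β i hχ
  · exact integral_dPhi_det_pd hy hF hw i hχ

variable {E : Exponents}

/-! ### Measurability and integrability of the components of a state -/

theorem memLp_vel (U : State E) : MemLp (vel U) 2 volume := Lp.memLp _

theorem memLp_defGrad (U : State E) : MemLp (defGrad U) (ENNReal.ofReal E.p) volume := Lp.memLp _

theorem memLp_zeta (U : State E) :
    MemLp (fun x => (xi U x).2.1) (ENNReal.ofReal E.q) volume := Lp.memLp _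

theorem memLp_w (U : State E) :
    MemLp (fun x => (xi U x).2.2) (ENNReal.ofReal E.ρ) volume := Lp.memLp _

theorem memLp_ent (U : State E) : MemLp (ent U) (ENNReal.ofReal E.l) volume := Lp.memLp _

theorem Exponents.one_le_p : 1 ≤ ENNReal.ofReal E.p := Fact.out
theorem Exponents.one_le_q : 1 ≤ ENNReal.ofReal E.q := Fact.out
theorem Exponents.one_le_ρ : 1 ≤ ENNReal.ofReal E.ρ := Fact.out
theorem Exponents.one_le_l : 1 ≤ ENNReal.ofReal E.l := Fact.out

theorem integrable_xiEnt (U : State E) : Integrable (xiEnt U) volume :=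
  ((((memLp_defGrad U).integrable Exponents.one_le_p).prodMk
    (((memLp_zeta U).integrable Exponents.one_le_q).prodMk
      ((memLp_w U).integrable Exponents.one_le_ρ))).prodMk
    ((memLp_ent U).integrable Exponents.one_le_l))

theorem aestronglyMeasurable_xiEnt (U : State E) : AEStronglyMeasurable (xiEnt U) volume :=
  (integrable_xiEnt U).1

theorem vel_comb (a b : ℝ) (U V : State E) :
    vel (a • U + b • V) =ᵐ[volume] fun x => a • vel U x + b • vel V x := by
  filter_upwards [Lp.coeFn_add (a • U.1) (b • V.1), Lp.coeFn_smul a U.1, Lp.coeFn_smul b V.1]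
    with x h1 h2 h3
  change (a • U.1 + b • V.1 : Lp V3 2 (volume : Measure T3)) x = _
  rw [h1, Pi.add_apply, h2, h3]; rfl

theorem xiEnt_comb (a b : ℝ) (U V : State E) :
    xiEnt (a • U + b • V) =ᵐ[volume] fun x => a • xiEnt U x + b • xiEnt V x := by
  filter_upwards [Lp.coeFn_add (a • U.2.1.1) (b • V.2.1.1), Lp.coeFn_smul a U.2.1.1,
    Lp.coeFn_smul b V.2.1.1, Lp.coeFn_add (a • U.2.1.2.1) (b • V.2.1.2.1),
    Lp.coeFn_smul a U.2.1.2.1, Lp.coeFn_smul b V.2.1.2.1,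
    Lp.coeFn_add (a • U.2.1.2.2) (b • V.2.1.2.2), Lp.coeFn_smul a U.2.1.2.2,
    Lp.coeFn_smul b V.2.1.2.2, Lp.coeFn_add (a • U.2.2) (b • V.2.2), Lp.coeFn_smul a U.2.2,
    Lp.coeFn_smul b V.2.2] with x f1 f2 f3 g1 g2 g3 h1 h2 h3 k1 k2 k3
  rw [Pi.add_apply, f2, f3] at f1
  rw [Pi.add_apply, g2, g3] at g1
  rw [Pi.add_apply, h2, h3] at h1
  rw [Pi.add_apply, k2, k3] at k1
  exact Prod.ext (Prod.ext f1 (Prod.ext g1 h1)) k1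

/-! ### The continuous map `U ↦ (ξ, η) ∈ L¹` -/

theorem integral_norm_le_Lp_norm {V : Type*} [NormedAddCommGroup V] {p : ENNReal} (hp : 1 ≤ p)
    (f : Lp V p (volume : Measure T3)) : ∫ x, ‖f x‖ ≤ ‖f‖ := by
  have h1 : MemLp f 1 volume := (Lp.memLp f).mono_exponent hp
  rw [Lp.norm_def, integral_norm_eq_lintegral_enorm h1.1, ← eLpNorm_one_eq_lintegral_enorm]
  exact ENNReal.toReal_mono (Lp.eLpNorm_ne_top f)
    (eLpNorm_le_eLpNorm_of_exponent_le hp h1.1)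

theorem norm_xiEnt_le (U : State E) (x : T3) : ‖xiEnt U x‖ ≤
    ‖U.2.1.1 x‖ + ‖U.2.1.2.1 x‖ + ‖U.2.1.2.2 x‖ + ‖U.2.2 x‖ := by
  have h : ∀ {A B : Type} [NormedAddCommGroup A] [NormedAddCommGroup B] (a : A) (b : B),
      ‖(a, b)‖ ≤ ‖a‖ + ‖b‖ := fun a b => by
    rw [Prod.norm_def]
    exact max_le (by simp) (by simp)
  calc ‖xiEnt U x‖ ≤ ‖xi U x‖ + ‖ent U x‖ := h _ _
    _ ≤ (‖U.2.1.1 x‖ + (‖U.2.1.2.1 x‖ + ‖U.2.1.2.2 x‖)) + ‖U.2.2 x‖ := by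
        gcongr
        · exact (h _ _).trans (by gcongr; exact h _ _)
        · exact le_rfl
    _ = _ := by ring

/-- The pair `(ξ, η)` as an element of `L¹`. -/
def xiEntL1 : State E →L[ℝ] Lp (Xi × ℝ) 1 (volume : Measure T3) :=
  LinearMap.mkContinuous
    { toFun := fun U => (memLp_one_iff_integrable.2 (integrable_xiEnt U)).toLp _
      map_add' := fun U V => by
        rw [← MemLp.toLp_add]
        refine MemLp.toLp_congr _ _ ?_
        have := xiEnt_comb 1 1 U V
        simpa using! this
      map_smul' := fun a U => by
        rw [RingHom.id_apply, ← MemLp.toLp_const_smul]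
        refine MemLp.toLp_congr _ _ ?_
        have := xiEnt_comb a 0 U U
        simpa using! this } 4 (fun U => by
    have e1 : ‖U.2.1.1‖ ≤ ‖U‖ := (norm_fst_le U.2.1).trans ((norm_fst_le U.2).trans (norm_snd_le U))
    have e2 : ‖U.2.1.2.1‖ ≤ ‖U‖ := (norm_fst_le U.2.1.2).trans ((norm_snd_le U.2.1).trans
      ((norm_fst_le U.2).trans (norm_snd_le U)))
    have e3 : ‖U.2.1.2.2‖ ≤ ‖U‖ := (norm_snd_le U.2.1.2).trans ((norm_snd_le U.2.1).trans
      ((norm_fst_le U.2).trans (norm_snd_le U)))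
    have e4 : ‖U.2.2‖ ≤ ‖U‖ := (norm_snd_le U.2).trans (norm_snd_le U)
    have i1 := ((Lp.memLp U.2.1.1).integrable Exponents.one_le_p).norm
    have i2 := ((Lp.memLp U.2.1.2.1).integrable Exponents.one_le_q).norm
    have i3 := ((Lp.memLp U.2.1.2.2).integrable Exponents.one_le_ρ).norm
    have i4 := ((Lp.memLp U.2.2).integrable Exponents.one_le_l).norm
    have hle := integral_mono (integrable_xiEnt U).norm (((i1.add i2).add i3).add i4)
      (fun x => norm_xiEnt_le U x)
    simp only [Pi.add_apply] at hle
    rw [integral_add (f := fun x => ‖U.2.1.1 x‖ + ‖U.2.1.2.1 x‖ + ‖U.2.1.2.2 x‖)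
        ((i1.add i2).add i3) i4,
      integral_add (f := fun x => ‖U.2.1.1 x‖ + ‖U.2.1.2.1 x‖) (i1.add i2) i3,
      integral_add i1 i2] at hle
    have hn : ‖(memLp_one_iff_integrable.2 (integrable_xiEnt U)).toLp _‖ = ∫ x, ‖xiEnt U x‖ := by
      rw [Lp.norm_toLp, eLpNorm_one_eq_lintegral_enorm,
        integral_norm_eq_lintegral_enorm (aestronglyMeasurable_xiEnt U)]
    refine hn.le.trans ?_
    linarith [integral_norm_le_Lp_norm Exponents.one_le_p U.2.1.1,
      integral_norm_le_Lp_norm Exponents.one_le_q U.2.1.2.1,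
      integral_norm_le_Lp_norm Exponents.one_le_ρ U.2.1.2.2,
      integral_norm_le_Lp_norm Exponents.one_le_l U.2.2])

theorem coeFn_xiEntL1 (U : State E) : xiEntL1 U =ᵐ[volume] xiEnt U :=
  MemLp.coeFn_toLp (memLp_one_iff_integrable.2 (integrable_xiEnt U))

/-! ### The constraints as level sets of linear forms -/

theorem integrable_pairing (c : Xi × ℝ →L[ℝ] ℝ) {φ : T3 → ℝ} (hφ : SmoothOnTorus φ)
    {z : T3 → Xi × ℝ} (hz : Integrable z volume) : Integrable (fun x => φ x * c (z x)) volume := by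
  simpa only [mul_comm] using SmoothOnTorus.integrable_mul (c.integrable_comp hz) hφ

/-- Pairing of a component of an `L¹` function with a test function. -/
def pairing (c : Xi × ℝ →L[ℝ] ℝ) {φ : T3 → ℝ} (hφ : SmoothOnTorus φ) :
    Lp (Xi × ℝ) 1 (volume : Measure T3) →L[ℝ] ℝ :=
  LinearMap.mkContinuousOfExistsBound
    { toFun := fun z => ∫ x, φ x * c (z x)
      map_add' := fun z z' => by
        rw [← integral_add (integrable_pairing c hφ (L1.integrable_coeFn z))
          (integrable_pairing c hφ (L1.integrable_coeFn z'))]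
        refine integral_congr_ae ?_
        filter_upwards [Lp.coeFn_add z z'] with x hx
        rw [hx, Pi.add_apply, map_add, mul_add]
      map_smul' := fun a z => by
        rw [RingHom.id_apply, smul_eq_mul, ← integral_const_mul]
        refine integral_congr_ae ?_
        filter_upwards [Lp.coeFn_smul a z] with x hx
        rw [hx, Pi.smul_apply, map_smul, smul_eq_mul]; ring } (by
    obtain ⟨K, hK0, hK⟩ := hφ.exists_bound
    refine ⟨K * ‖c‖, fun z => ?_⟩
    have hz := L1.integrable_coeFn z
    calc ‖∫ x, φ x * c (z x)‖ ≤ ∫ x, ‖φ x * c (z x)‖ := norm_integral_le_integral_norm _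
      _ ≤ ∫ x, K * ‖c‖ * ‖z x‖ := by
          refine integral_mono (integrable_pairing c hφ hz).norm (hz.norm.const_mul _) fun x => ?_
          simp only [norm_mul]
          rw [mul_assoc]
          exact mul_le_mul (hK x) (c.le_opNorm _) (norm_nonneg _) hK0
      _ = K * ‖c‖ * ∫ x, ‖z x‖ := integral_const_mul _ _
      _ ≤ K * ‖c‖ * ‖z‖ := by
          gcongr
          exact integral_norm_le_Lp_norm le_rfl z)

theorem pairing_xiEntL1 (c : Xi × ℝ →L[ℝ] ℝ) {φ : T3 → ℝ} (hφ : SmoothOnTorus φ) (U : State E) :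
    pairing c hφ (xiEntL1 U) = ∫ x, φ x * c (xiEnt U x) := by
  refine integral_congr_ae ?_
  filter_upwards [coeFn_xiEntL1 U] with x hx
  rw [hx]

/-- The component `ξ^B` as a linear form of `(ξ, η)`. -/
def compCLM : Idx → (Xi × ℝ →L[ℝ] ℝ)
  | Sum.inl a => (EuclideanSpace.proj a : M3 →L[ℝ] ℝ).comp
      ((ContinuousLinearMap.fst ℝ M3 (M3 × ℝ)).comp (ContinuousLinearMap.fst ℝ Xi ℝ))
  | Sum.inr (Sum.inl a) => (EuclideanSpace.proj a : M3 →L[ℝ] ℝ).comp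
      (((ContinuousLinearMap.fst ℝ M3 ℝ).comp (ContinuousLinearMap.snd ℝ M3 (M3 × ℝ))).comp
        (ContinuousLinearMap.fst ℝ Xi ℝ))
  | Sum.inr (Sum.inr _) =>
      ((ContinuousLinearMap.snd ℝ M3 ℝ).comp (ContinuousLinearMap.snd ℝ M3 (M3 × ℝ))).comp
        (ContinuousLinearMap.fst ℝ Xi ℝ)

theorem compCLM_apply (B : Idx) (z : Xi × ℝ) : compCLM B z = comp z.1 B := by
  rcases B with a | a | u <;> rfl

theorem memLp_norm_sq_defGrad (U : State E) :
    MemLp (fun x => ‖defGrad U x‖ ^ 2) (ENNReal.ofReal (E.p / 2)) volume := by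
  have h := (memLp_defGrad U).norm_rpow_div 2
  have e : ENNReal.ofReal E.p / 2 = ENNReal.ofReal (E.p / 2) := by
    rw [ENNReal.ofReal_div_of_pos two_pos]; simp
  rw [e] at h
  simpa using h

theorem aestronglyMeasurable_dPhi (U : State E) (B : Idx) (i α : Fin 3) :
    AEStronglyMeasurable (fun x => dPhi B i α (defGrad U x)) volume :=
  (continuous_dPhi B i α).comp_aestronglyMeasurable (memLp_defGrad U).1

theorem memLp_dPhi_inl (U : State E) (a : Fin 3 × Fin 3) (i α : Fin 3) (p : ENNReal) :
    MemLp (fun x => dPhi (Sum.inl a) i α (defGrad U x)) p volume :=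
  MemLp.of_bound (aestronglyMeasurable_dPhi U _ i α) 1 (ae_of_all _ fun _ => abs_dPhi_inl_le a i α _)

theorem memLp_dPhi_cof (U : State E) (a : Fin 3 × Fin 3) (i α : Fin 3) :
    MemLp (fun x => dPhi (Sum.inr (Sum.inl a)) i α (defGrad U x)) (ENNReal.ofReal E.p) volume :=
  (memLp_defGrad U).of_le_mul (aestronglyMeasurable_dPhi U _ i α)
    (ae_of_all _ fun _ => abs_dPhi_cof_le a i α _)

theorem memLp_dPhi_det (U : State E) (u : Unit) (i α : Fin 3) :
    MemLp (fun x => dPhi (Sum.inr (Sum.inr u)) i α (defGrad U x))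
      (ENNReal.ofReal (E.p / 2)) volume :=
  (memLp_norm_sq_defGrad U).of_le_mul (aestronglyMeasurable_dPhi U _ i α)
    (ae_of_all _ fun x => by simpa using abs_dPhi_det_le u i α (defGrad U x))

theorem two_le_ofReal {a : ℝ} (ha : 2 ≤ a) : (2 : ENNReal) ≤ ENNReal.ofReal a := by
  rw [← ENNReal.ofReal_ofNat]; exact ENNReal.ofReal_le_ofReal ha

/-- This is where `p ≥ 4` enters: `∂det/∂F` is quadratic in `F`, hence in `L^{p/2} ⊆ L²`, and can be
paired with an `L²` velocity. -/
theorem memLp_dPhi_two (U : State E) (B : Idx) (i α : Fin 3) :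
    MemLp (fun x => dPhi B i α (defGrad U x)) 2 volume := by
  have := E.four_le_p
  rcases B with a | a | u
  · exact memLp_dPhi_inl U a i α 2
  · exact (memLp_dPhi_cof U a i α).mono_exponent (two_le_ofReal (by linarith))
  · exact (memLp_dPhi_det U u i α).mono_exponent (two_le_ofReal (by linarith))

/-- The vector field `i ↦ ∂Φ^B/∂F_{iα}(F⁰) ∂_α φ`. -/
def fluxField (U0 : State E) (B : Idx) (φ : T3 → ℝ) (x : T3) : V3 :=
  WithLp.toLp 2 fun i => ∑ α, dPhi B i α (defGrad U0 x) * pd α φ x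

theorem memLp_fluxField (U0 : State E) (B : Idx) {φ : T3 → ℝ} (hφ : SmoothOnTorus φ) :
    MemLp (fluxField U0 B φ) 2 volume :=
  MemLp.of_eval_piLp fun i => memLp_finsetSum (p := 2) (f := fun α x =>
    dPhi B i α (defGrad U0 x) * pd α φ x) Finset.univ fun α _ =>
    memLp_mul_smooth (memLp_dPhi_two U0 B i α) (hφ.pd α)

/-- The linear form whose level sets express the transport equations. -/
def transportForm (h : ℝ) (U0 : State E) (B : Idx) {φ : T3 → ℝ} (hφ : SmoothOnTorus φ) :
    State E →L[ℝ] ℝ :=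
  (1 / h) • (pairing (compCLM B) hφ).comp xiEntL1
    + (innerSL ℝ ((memLp_fluxField U0 B hφ).toLp _)).comp (ContinuousLinearMap.fst ℝ _ _)

theorem inner_fluxField (U0 : State E) (B : Idx) {φ : T3 → ℝ} (hφ : SmoothOnTorus φ)
    (U : State E) : inner ℝ ((memLp_fluxField U0 B hφ).toLp _) U.1
      = ∫ x, ∑ i, ∑ α, dPhi B i α (defGrad U0 x) * vel U x i * pd α φ x := by
  rw [L2.inner_def]
  refine integral_congr_ae ?_
  filter_upwards [(memLp_fluxField U0 B hφ).coeFn_toLp] with x hx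
  rw [hx, PiLp.inner_apply]
  refine Finset.sum_congr rfl fun i _ => ?_
  simp only [fluxField, RCLike.inner_apply, conj_trivial, Finset.mul_sum, vel]
  exact Finset.sum_congr rfl fun α _ => by ring

theorem transportEq_iff {h : ℝ} {U0 U : State E} : TransportEq h U0 U ↔
    ∀ (B : Idx) (φ : T3 → ℝ) (hφ : SmoothOnTorus φ), transportForm h U0 B hφ U
      = 1 / h * pairing (compCLM B) hφ (xiEntL1 U0) := by
  refine forall_congr' fun B => forall_congr' fun φ => forall_congr' fun hφ => ?_
  have h1 : transportForm h U0 B hφ U = 1 / h * pairing (compCLM B) hφ (xiEntL1 U)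
      + inner ℝ ((memLp_fluxField U0 B hφ).toLp _) U.1 := rfl
  have h2 : ∫ x, φ x * (1 / h * (comp (xi U x) B - comp (xi U0 x) B))
      = 1 / h * pairing (compCLM B) hφ (xiEntL1 U)
        - 1 / h * pairing (compCLM B) hφ (xiEntL1 U0) := by
    rw [pairing_xiEntL1, pairing_xiEntL1, ← mul_sub,
      ← integral_sub (integrable_pairing _ hφ (integrable_xiEnt U))
        (integrable_pairing _ hφ (integrable_xiEnt U0)), ← integral_const_mul]
    refine integral_congr_ae (ae_of_all _ fun x => ?_)
    simp only [compCLM_apply, xiEnt]; ring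
  rw [h1, h2, inner_fluxField U0 B hφ U]
  constructor <;> intro H <;> linarith

/-- The linear form whose level sets express the entropy equation. -/
def entropyForm (h : ℝ) {φ : T3 → ℝ} (hφ : SmoothOnTorus φ) : State E →L[ℝ] ℝ :=
  (1 / h) • (pairing (ContinuousLinearMap.snd ℝ Xi ℝ) hφ).comp xiEntL1

theorem entropyForm_apply (h : ℝ) {φ : T3 → ℝ} (hφ : SmoothOnTorus φ) (U : State E) :
    entropyForm h hφ U = 1 / h * ∫ x, φ x * ent U x :=
  congrArg (1 / h * ·) (pairing_xiEntL1 (ContinuousLinearMap.snd ℝ Xi ℝ) hφ U)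

theorem entropyEq_iff {e : Xi × ℝ → ℝ} {r : T3 → ℝ} {h : ℝ} {U0 U : State E} :
    EntropyEq e r h U0 U ↔ ∀ (φ : T3 → ℝ) (hφ : SmoothOnTorus φ), entropyForm h hφ U
      = entropyForm h hφ U0 + ∫ x, r x / theta e (xiEnt U0 x) * φ x := by
  refine forall_congr' fun φ => forall_congr' fun hφ => ?_
  have hi : ∀ U : State E, Integrable (fun x => φ x * ent U x) volume := fun U =>
    integrable_pairing (ContinuousLinearMap.snd ℝ Xi ℝ) hφ (integrable_xiEnt U)
  have h2 : ∫ x, φ x * (1 / h * (ent U x - ent U0 x))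
      = entropyForm h hφ U - entropyForm h hφ U0 := by
    rw [entropyForm_apply, entropyForm_apply, ← mul_sub, ← integral_sub (hi U) (hi U0),
      ← integral_const_mul]
    refine integral_congr_ae (ae_of_all _ fun x => ?_)
    ring
  rw [h2]
  constructor <;> intro H <;> linarith

/-! ### Affine structure and closedness of the admissible set; the entropy update -/

section Admissible

variable {e : Xi × ℝ → ℝ} {r : T3 → ℝ} {h : ℝ} {U0 : State E}

theorem exists_affineSubspace_admissible :
    ∃ A : AffineSubspace ℝ (State E), (A : Set (State E)) = admissible e r h U0 := by
  refine ⟨⟨admissible e r h U0, ?_⟩, rfl⟩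
  rintro c U V W ⟨hU, hU'⟩ ⟨hV, hV'⟩ ⟨hW, hW'⟩
  rw [transportEq_iff] at hU hV hW
  rw [entropyEq_iff] at hU' hV' hW'
  refine ⟨transportEq_iff.2 fun B φ hφ => ?_, entropyEq_iff.2 fun φ hφ => ?_⟩
  · rw [vsub_eq_sub, vadd_eq_add, map_add, map_smul, map_sub, hU, hV, hW]; simp
  · rw [vsub_eq_sub, vadd_eq_add, map_add, map_smul, map_sub, hU', hV', hW']; simp

theorem comb_mem_admissible {U V : State E} (hU : U ∈ admissible e r h U0)
    (hV : V ∈ admissible e r h U0) {a b : ℝ} (hab : a + b = 1) :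
    a • U + b • V ∈ admissible e r h U0 := by
  obtain ⟨A, hA⟩ := exists_affineSubspace_admissible (e := e) (r := r) (h := h) (U0 := U0)
  rw [← hA] at hU hV ⊢
  have h1 : b = 1 - a := by linarith
  have := A.smul_vsub_vadd_mem a hU hV hV
  rw [vsub_eq_sub, vadd_eq_add] at this
  rw [h1, show a • U + (1 - a) • V = a • (U - V) + V by module]
  exact this

/-- The constraint forms factor through `v ∈ L²` and `(ξ, η) ∈ L¹`, so convergence in these weaker
norms suffices. It is the only convergence available for minimizing sequences. -/
theorem mem_admissible_of_tendsto {U : State E} {S : ℕ → State E}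
    (hS : ∀ n, S n ∈ admissible e r h U0) (hv : Tendsto (fun n => (S n).1) atTop (𝓝 U.1))
    (hz : Tendsto (fun n => xiEntL1 (S n)) atTop (𝓝 (xiEntL1 U))) :
    U ∈ admissible e r h U0 := by
  refine ⟨transportEq_iff.2 fun B φ hφ => ?_, entropyEq_iff.2 fun φ hφ => ?_⟩
  · have h1 : Tendsto (fun n => transportForm h U0 B hφ (S n)) atTop
        (𝓝 (transportForm h U0 B hφ U)) :=
      ((((pairing (compCLM B) hφ).continuous.tendsto _).comp hz).const_smul (1 / h)).add
        (((innerSL ℝ ((memLp_fluxField U0 B hφ).toLp _)).continuous.tendsto _).comp hv)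
    simp_rw [fun n => transportEq_iff.1 (hS n).1 B φ hφ] at h1
    exact tendsto_nhds_unique h1 tendsto_const_nhds
  · have h1 : Tendsto (fun n => entropyForm h hφ (S n)) atTop (𝓝 (entropyForm h hφ U)) :=
      (((pairing (ContinuousLinearMap.snd ℝ Xi ℝ) hφ).continuous.tendsto _).comp hz).const_smul
        (1 / h)
    simp_rw [fun n => entropyEq_iff.1 (hS n).2 φ hφ] at h1
    exact tendsto_nhds_unique h1 tendsto_const_nhds

theorem isClosed_admissible : IsClosed (admissible e r h U0) := by
  rw [← isSeqClosed_iff_isClosed]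
  intro S U hS hlim
  exact mem_admissible_of_tendsto hS ((continuous_fst.tendsto _).comp hlim)
    ((xiEntL1.continuous.tendsto _).comp hlim)

/-- Convex sets have the same closure in the norm and weak topologies. -/
theorem isClosed_toWeakSpace_admissible :
    IsClosed (toWeakSpace ℝ (State E) '' admissible e r h U0) := by
  have hc : Convex ℝ (admissible e r h U0) := fun U hU V hV a b _ _ hab =>
    comb_mem_admissible hU hV hab
  have := hc.toWeakSpace_closure ℝ
  rw [isClosed_admissible.closure_eq] at this
  rw [this]; exact isClosed_closure

theorem ent_eq_of_mem_admissible (hh : h ≠ 0)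
    (hr : MemLp (fun x => r x / theta e (xiEnt U0 x)) (ENNReal.ofReal E.l) volume)
    {U : State E} (hU : U ∈ admissible e r h U0) :
    ∀ᵐ x, ent U x = ent U0 x + h * (r x / theta e (xiEnt U0 x)) := by
  have hi := fun U : State E => (memLp_ent U).integrable Exponents.one_le_l
  have hri := hr.integrable Exponents.one_le_l
  have hd : Integrable (fun x => 1 / h * (ent U x - ent U0 x) - r x / theta e (xiEnt U0 x))
      volume := (((hi U).sub (hi U0)).const_mul _).sub hri
  have h0 := ae_eq_zero_of_forall_smooth hd fun φ hφ => by
    have h1 : Integrable (fun x => 1 / h * (ent U x - ent U0 x)) volume :=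
      ((hi U).sub (hi U0)).const_mul _
    simp_rw [sub_mul]
    rw [integral_sub (SmoothOnTorus.integrable_mul h1 hφ) (SmoothOnTorus.integrable_mul hri hφ),
      ← hU.2 φ hφ, sub_eq_zero]
    refine integral_congr_ae (ae_of_all _ fun x => ?_)
    ring
  filter_upwards [h0] with x hx
  have hx' : 1 / h * (ent U x - ent U0 x) = r x / theta e (xiEnt U0 x) := sub_eq_zero.1 hx
  rw [← hx']; field_simp; ring

end Admissible

/-! ### The gradient constraint -/

/-- For the components `Φ^B = F_{iα}` the coefficients are Kronecker deltas, and the transport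
equation reads `F - F⁰ = h ∇v`. -/
theorem hasWeakGradient_of_mem_admissible {e : Xi × ℝ → ℝ} {r : T3 → ℝ} {h : ℝ} {U0 U : State E}
    {y0 : T3 → V3} (hh : h ≠ 0) (hy0 : MemW1 E.p y0) (hF0 : HasWeakGradient y0 (defGrad U0))
    (hU : U ∈ admissible e r h U0) :
    HasWeakGradient (fun x => y0 x + h • vel U x) (defGrad U) := by
  intro i α φ hφ
  have hFi : ∀ U : State E, Integrable (fun x => defGrad U x (i, α)) volume := fun U =>
    ((memLp_defGrad U).eval_piLp (i, α)).integrable Exponents.one_le_p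
  have hyi : Integrable (fun x => y0 x i) volume :=
    (hy0.1.eval_piLp i).integrable Exponents.one_le_p
  have hvi : Integrable (fun x => vel U x i) volume :=
    ((memLp_vel U).eval_piLp i).integrable one_le_two
  have ht := hU.1 (Sum.inl (i, α)) φ hφ
  have e1 : ∀ x, ∑ j, ∑ β, dPhi (Sum.inl (i, α)) j β (defGrad U0 x) * vel U x j * pd β φ x
      = vel U x i * pd α φ x := by
    intro x
    simp only [dPhi_inl, Prod.mk.injEq]
    rw [Finset.sum_eq_single i, Finset.sum_eq_single α]
    · simp
    · intro β _ hβ; simp [hβ.symm]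
    · simp
    · intro j _ hj; simp [hj.symm]
    · simp
  simp_rw [e1] at ht
  have e2 : ∫ x, φ x * (1 / h * (comp (xi U x) (Sum.inl (i, α)) - comp (xi U0 x) (Sum.inl (i, α))))
      = 1 / h * (∫ x, defGrad U x (i, α) * φ x) - 1 / h * ∫ x, defGrad U0 x (i, α) * φ x := by
    rw [← mul_sub, ← integral_sub (SmoothOnTorus.integrable_mul (hFi U) hφ)
      (SmoothOnTorus.integrable_mul (hFi U0) hφ), ← integral_const_mul]
    refine integral_congr_ae (ae_of_all _ fun x => ?_)
    simp only [comp, xi, defGrad]; ring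
  rw [e2, hF0 i α φ hφ] at ht
  have e3 : ∫ x, (y0 x + h • vel U x) i * pd α φ x
      = (∫ x, y0 x i * pd α φ x) + h * ∫ x, vel U x i * pd α φ x := by
    rw [← integral_const_mul, ← integral_add (SmoothOnTorus.integrable_mul hyi (hφ.pd α))
      ((SmoothOnTorus.integrable_mul hvi (hφ.pd α)).const_mul _)]
    refine integral_congr_ae (ae_of_all _ fun x => ?_)
    simp only [PiLp.add_apply, PiLp.smul_apply, smul_eq_mul]; ring
  rw [e3]
  field_simp at ht
  linarith

/-- The potential `y⁰ + h v` is not known to be in `L^p`, since `v` is only in `L²`. It serves to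
show that `F` is curl-free and, on testing with the constant `1`, of mean zero; the averaged line
integrals of `F ∈ L^p` then give a potential in `L^p`. -/
theorem gradient_constraint {e : Xi × ℝ → ℝ} {r : T3 → ℝ} {h : ℝ} {U0 U : State E}
    {y0 : T3 → V3} (hh : h ≠ 0) (hy0 : MemW1 E.p y0) (hF0 : HasWeakGradient y0 (defGrad U0))
    (hU : U ∈ admissible e r h U0) :
    CurlFree (defGrad U) ∧ ∃ y : T3 → V3, MemW1 E.p y ∧ HasWeakGradient y (defGrad U) := by
  have hw := hasWeakGradient_of_mem_admissible hh hy0 hF0 hU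
  refine ⟨hw.curlFree, ?_⟩
  obtain ⟨y, hy, hyw⟩ := exists_potential Exponents.one_le_p ENNReal.ofReal_ne_top
    (memLp_defGrad U) hw.curlFree fun a => by
      have := hw a.1 a.2 _ (SmoothOnTorus.const 1)
      simpa [pd] using this
  exact ⟨y, ⟨hy, _, memLp_defGrad U, hyw⟩, hyw⟩

/-! ### The internal energy -/

/-- Truncation of the entropy at `0`, a retraction onto the domain of the energy. -/
def clamp (z : Xi × ℝ) : Xi × ℝ := (z.1, max z.2 0)

theorem clamp_mem (z : Xi × ℝ) : clamp z ∈ energyDom := le_max_right z.2 0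

theorem clamp_of_mem {z : Xi × ℝ} (hz : z ∈ energyDom) : clamp z = z :=
  Prod.ext rfl (max_eq_left hz)

theorem continuous_clamp : Continuous clamp :=
  continuous_fst.prodMk (continuous_snd.max continuous_const)

/-- Yields measurability of `e ∘ z` when `z` takes values in the domain of `e` only almost
everywhere. -/
theorem continuous_comp_clamp {e : Xi × ℝ → ℝ} (he : ContinuousOn e energyDom) :
    Continuous fun z => e (clamp z) :=
  he.comp_continuous continuous_clamp clamp_mem

theorem isClosed_energyDom : IsClosed energyDom := isClosed_le continuous_const continuous_snd

theorem gauge_nonneg (z : Xi × ℝ) : 0 ≤ gauge E z := by unfold gauge; positivity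

theorem integrable_norm_rpow_ofReal {V : Type*} [NormedAddCommGroup V] {f : T3 → V} {p : ℝ}
    (hp : 1 ≤ p) (hf : MemLp f (ENNReal.ofReal p) volume) :
    Integrable (fun x => ‖f x‖ ^ p) volume := by
  have := hf.integrable_norm_rpow (by simp; linarith) ENNReal.ofReal_ne_top
  rwa [ENNReal.toReal_ofReal (by linarith)] at this

theorem memLp_of_integrable_rpow {V : Type*} [NormedAddCommGroup V] {f : T3 → V} {p : ℝ}
    (hp : 1 ≤ p) (hf : AEStronglyMeasurable f volume)
    (hi : Integrable (fun x => ‖f x‖ ^ p) volume) : MemLp f (ENNReal.ofReal p) volume := by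
  refine (integrable_norm_rpow_iff hf (by simp; linarith) ENNReal.ofReal_ne_top).1 ?_
  rwa [ENNReal.toReal_ofReal (by linarith)]

theorem Exponents.one_le_p' : 1 ≤ E.p := by linarith [E.four_le_p]
theorem Exponents.one_le_q' : 1 ≤ E.q := by linarith [E.two_le_q]

theorem integrable_gauge (U : State E) : Integrable (fun x => gauge E (xiEnt U x)) volume :=
  (((integrable_norm_rpow_ofReal E.one_le_p' (memLp_defGrad U)).add
    (integrable_norm_rpow_ofReal E.one_le_q' (memLp_zeta U))).add
    (integrable_norm_rpow_ofReal E.one_lt_ρ.le (memLp_w U))).add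
    (integrable_norm_rpow_ofReal E.one_lt_l.le (memLp_ent U))

theorem integrable_energy {e : Xi × ℝ → ℝ} (he : ContinuousOn e energyDom)
    (hg : EnergyGrowth E e) {z : T3 → Xi × ℝ} (hz : AEStronglyMeasurable z volume)
    (hzd : ∀ᵐ x, z x ∈ energyDom) (hi : Integrable (fun x => gauge E (z x)) volume) :
    Integrable (fun x => e (z x)) volume := by
  obtain ⟨c, C, hc, hgr⟩ := hg
  have hm : AEStronglyMeasurable (fun x => e (z x)) volume := by
    refine ((continuous_comp_clamp he).comp_aestronglyMeasurable hz).congr ?_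
    filter_upwards [hzd] with x hx
    rw [clamp_of_mem hx]
  refine Integrable.mono' ((hi.const_mul |C|).add (integrable_const |C|)) hm ?_
  filter_upwards [hzd] with x hx
  have h1 := hgr _ hx
  have h2 := gauge_nonneg (E := E) (z x)
  rw [Real.norm_eq_abs, abs_le, Pi.add_apply]
  have h3 : C * gauge E (z x) ≤ |C| * gauge E (z x) := by gcongr; exact le_abs_self C
  constructor
  · nlinarith [mul_nonneg hc.le h2, mul_nonneg (abs_nonneg C) h2, le_abs_self C]
  · linarith [le_abs_self C]

theorem integrable_kinetic (U0 U : State E) :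
    Integrable (fun x => 1 / 2 * ‖vel U x - vel U0 x‖ ^ 2) volume :=
  (((memLp_vel U).sub (memLp_vel U0)).integrable_norm_pow two_ne_zero).const_mul _

theorem integrable_energyDensity {e : Xi × ℝ → ℝ} (he : ContinuousOn e energyDom)
    (hg : EnergyGrowth E e) (U0 : State E) {U : State E} (hU : ∀ᵐ x, 0 ≤ ent U x) :
    Integrable (energyDensity e U0 U) volume :=
  (integrable_kinetic U0 U).add
    (integrable_energy he hg (aestronglyMeasurable_xiEnt U) hU (integrable_gauge U))

/-! ### The convexity defect -/

/-- The midpoint convexity defect of the energy. -/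
def defect (e : Xi × ℝ → ℝ) (z z' : Xi × ℝ) : ℝ :=
  (e z + e z') / 2 - e ((1 / 2 : ℝ) • z + (1 / 2 : ℝ) • z')

theorem midpoint_mem_energyDom {z z' : Xi × ℝ} (hz : z ∈ energyDom) (hz' : z' ∈ energyDom) :
    (1 / 2 : ℝ) • z + (1 / 2 : ℝ) • z' ∈ energyDom := by
  have h1 : 0 ≤ z.2 := hz
  have h2 : 0 ≤ z'.2 := hz'
  change 0 ≤ (1 / 2 : ℝ) * z.2 + (1 / 2 : ℝ) * z'.2
  linarith

theorem defect_nonneg {e : Xi × ℝ → ℝ} (hc : StrictConvexOn ℝ energyDom e) {z z' : Xi × ℝ}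
    (hz : z ∈ energyDom) (hz' : z' ∈ energyDom) : 0 ≤ defect e z z' := by
  have := hc.convexOn.2 hz hz' (by norm_num : (0 : ℝ) ≤ 1 / 2) (by norm_num : (0 : ℝ) ≤ 1 / 2)
    (by norm_num)
  simp only [smul_eq_mul] at this
  unfold defect; linarith

theorem defect_pos {e : Xi × ℝ → ℝ} (hc : StrictConvexOn ℝ energyDom e) {z z' : Xi × ℝ}
    (hz : z ∈ energyDom) (hz' : z' ∈ energyDom) (hne : z ≠ z') : 0 < defect e z z' := by
  have := hc.2 hz hz' hne (by norm_num : (0 : ℝ) < 1 / 2) (by norm_num : (0 : ℝ) < 1 / 2)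
    (by norm_num)
  simp only [smul_eq_mul] at this
  unfold defect; linarith

theorem continuousOn_defect {e : Xi × ℝ → ℝ} (he : ContinuousOn e energyDom) :
    ContinuousOn (fun w : (Xi × ℝ) × (Xi × ℝ) => defect e w.1 w.2) (energyDom ×ˢ energyDom) := by
  refine ContinuousOn.sub (ContinuousOn.div_const (ContinuousOn.add ?_ ?_) _) ?_
  · exact he.comp continuousOn_fst fun w hw => hw.1
  · exact he.comp continuousOn_snd fun w hw => hw.2
  · exact he.comp (by fun_prop) fun w hw => midpoint_mem_energyDom hw.1 hw.2

theorem eventually_mul_le_rpow {s : ℝ} (hs : 1 < s) (M : ℝ) :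
    ∀ᶠ t : ℝ in atTop, M * t ≤ t ^ s := by
  filter_upwards [(tendsto_rpow_atTop (sub_pos.2 hs)).eventually_ge_atTop M, eventually_gt_atTop 0]
    with t h1 h2
  have : t ^ s = t ^ (s - 1) * t := by
    rw [← Real.rpow_add_one h2.ne']; ring_nf
  rw [this]; gcongr

/-- All four exponents exceed 1, and the norm is the maximum of the four component norms, so the
largest component alone makes the gauge superlinear. -/
theorem exists_mul_norm_le_gauge (M : ℝ) : ∃ R, ∀ z : Xi × ℝ, R < ‖z‖ → M * ‖z‖ ≤ gauge E z := by
  have hp : 1 < E.p := by linarith [E.four_le_p]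
  have hq : 1 < E.q := by linarith [E.two_le_q]
  obtain ⟨R, hR⟩ := eventually_atTop.1 ((((eventually_mul_le_rpow hp M).and
    (eventually_mul_le_rpow hq M)).and (eventually_mul_le_rpow E.one_lt_ρ M)).and
    (eventually_mul_le_rpow E.one_lt_l M))
  refine ⟨R, fun z hz => ?_⟩
  obtain ⟨⟨⟨h1, h2⟩, h3⟩, h4⟩ := hR _ hz.le
  have n1 : 0 ≤ ‖z.1.1‖ ^ E.p := by positivity
  have n2 : 0 ≤ ‖z.1.2.1‖ ^ E.q := by positivity
  have n3 : 0 ≤ |z.1.2.2| ^ E.ρ := by positivity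
  have n4 : 0 ≤ |z.2| ^ E.l := by positivity
  have hn : ‖z‖ = max (max ‖z.1.1‖ (max ‖z.1.2.1‖ |z.1.2.2|)) |z.2| := by
    simp [Prod.norm_def]
  have hcases : ‖z‖ = ‖z.1.1‖ ∨ ‖z‖ = ‖z.1.2.1‖ ∨ ‖z‖ = |z.1.2.2| ∨ ‖z‖ = |z.2| := by
    rw [hn]
    rcases max_choice (max ‖z.1.1‖ (max ‖z.1.2.1‖ |z.1.2.2|)) |z.2| with h | h
    · rcases max_choice ‖z.1.1‖ (max ‖z.1.2.1‖ |z.1.2.2|) with h' | h'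
      · left; rw [h, h']
      · rcases max_choice ‖z.1.2.1‖ |z.1.2.2| with h'' | h''
        · right; left; rw [h, h', h'']
        · right; right; left; rw [h, h', h'']
    · right; right; right; exact h
  unfold gauge
  rcases hcases with h | h | h | h
  · rw [← h] at n1 ⊢; linarith
  · rw [← h] at n2 ⊢; linarith
  · rw [← h] at n3 ⊢; linarith
  · rw [← h] at n4 ⊢; linarith

/-- Quantitative strict convexity: the distance of two points is controlled by the convexity
defect, up to a small multiple of the gauge. -/
theorem norm_sub_le_defect {e : Xi × ℝ → ℝ} (he : ContinuousOn e energyDom)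
    (hc : StrictConvexOn ℝ energyDom e) {ε : ℝ} (hε : 0 < ε) :
    ∃ K, 0 ≤ K ∧ ∀ z ∈ energyDom, ∀ z' ∈ energyDom,
      ‖z - z'‖ ≤ ε * (1 + gauge E z + gauge E z') + K * defect e z z' := by
  obtain ⟨R, hR⟩ := exists_mul_norm_le_gauge (E := E) (2 / ε)
  have hR' : ∀ z : Xi × ℝ, R < ‖z‖ → 2 * ‖z‖ ≤ ε * gauge E z := by
    intro z hz
    have := mul_le_mul_of_nonneg_left (hR z hz) hε.le
    calc 2 * ‖z‖ = ε * (2 / ε * ‖z‖) := by field_simp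
      _ ≤ _ := this
  -- Bounded pairs at distance at least `ε` form a compact set, on which the defect has a positive
  -- lower bound `δ`.
  let S : Set ((Xi × ℝ) × (Xi × ℝ)) :=
    (Metric.closedBall 0 R) ∩ ((energyDom ×ˢ energyDom) ∩ {w | ε ≤ ‖w.1 - w.2‖})
  have hS : IsCompact S := (isCompact_closedBall 0 R).inter_right
    ((isClosed_energyDom.prod isClosed_energyDom).inter
      (isClosed_le continuous_const (by fun_prop)))
  obtain ⟨δ, hδ, hδS⟩ := hS.exists_forall_le' (f := fun w => defect e w.1 w.2) (a := 0)
    ((continuousOn_defect he).mono fun w hw => hw.2.1) (fun w hw => by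
      refine defect_pos hc hw.2.1.1 hw.2.1.2 fun heq => ?_
      have : ε ≤ ‖w.1 - w.2‖ := hw.2.2
      rw [heq, sub_self, norm_zero] at this
      linarith)
  -- With this `K`, on `S` the defect term alone is at least `2|R| ≥ ‖z - z'‖`. Bounded pairs closer
  -- than `ε` are covered by the summand `ε · 1`. If a point leaves the ball, the one of larger norm
  -- satisfies `‖z - z'‖ ≤ 2‖z‖ ≤ ε · gauge`.
  refine ⟨2 * |R| / δ, by positivity, fun z hz z' hz' => ?_⟩
  have hD := defect_nonneg hc hz hz'
  have hKD : 0 ≤ 2 * |R| / δ * defect e z z' := by positivity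
  have g1 := gauge_nonneg (E := E) z
  have g2 := gauge_nonneg (E := E) z'
  have htri := norm_sub_le z z'
  have e1 : 0 ≤ ε * gauge E z := by positivity
  have e2 : 0 ≤ ε * gauge E z' := by positivity
  by_cases hb : ‖z‖ ≤ R ∧ ‖z'‖ ≤ R
  · by_cases hd : ε ≤ ‖z - z'‖
    · have hmem : (z, z') ∈ S := by
        refine ⟨?_, ⟨hz, hz'⟩, hd⟩
        rw [mem_closedBall_zero_iff, Prod.norm_def]
        exact max_le hb.1 hb.2
      have h1 := hδS _ hmem
      have h2 : 2 * |R| ≤ 2 * |R| / δ * defect e z z' := by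
        rw [div_mul_eq_mul_div, le_div_iff₀ hδ]
        gcongr
      linarith [le_abs_self R]
    · linarith
  · rw [not_and_or, not_le, not_le] at hb
    rcases le_total ‖z'‖ ‖z‖ with hle | hle
    · have : R < ‖z‖ := by
        rcases hb with hb | hb
        · exact hb
        · exact hb.trans_le hle
      linarith [hR' z this]
    · have : R < ‖z'‖ := by
        rcases hb with hb | hb
        · exact hb.trans_le hle
        · exact hb
      linarith [hR' z' this]

/-! ### Existence and uniqueness of the minimizer -/

section Minimizer

variable {e : Xi × ℝ → ℝ} {r : T3 → ℝ} {h : ℝ} {U0 : State E}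

theorem norm_sub_sq_eq_integral (U V : State E) :
    ‖U.1 - V.1‖ ^ 2 = ∫ x, ‖vel U x - vel V x‖ ^ 2 := by
  rw [← real_inner_self_eq_norm_sq, L2.inner_def]
  refine integral_congr_ae ?_
  filter_upwards [Lp.coeFn_sub U.1 V.1] with x hx
  rw [hx, real_inner_self_eq_norm_sq]; rfl

theorem norm_xiEntL1_sub (U V : State E) :
    ‖xiEntL1 U - xiEntL1 V‖ = ∫ x, ‖xiEnt U x - xiEnt V x‖ := by
  rw [L1.norm_eq_integral_norm]
  refine integral_congr_ae ?_
  filter_upwards [Lp.coeFn_sub (xiEntL1 U) (xiEntL1 V), coeFn_xiEntL1 U, coeFn_xiEntL1 V]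
    with x h1 h2 h3
  rw [h1, Pi.sub_apply, h2, h3]

theorem integral_gauge_le (he : ContinuousOn e energyDom) (hg : EnergyGrowth E e) :
    ∃ c C : ℝ, 0 < c ∧ ∀ U0 U : State E, (∀ᵐ x, 0 ≤ ent U x) →
      c * ∫ x, gauge E (xiEnt U x) ≤ J e U0 U + C := by
  have hg' := hg
  obtain ⟨c, C, hc, hgr⟩ := hg
  refine ⟨c, C, hc, fun U0 U hU => ?_⟩
  have hi := integrable_energyDensity he hg' U0 hU
  have h1 : ∫ x, (c * gauge E (xiEnt U x) - C) ≤ J e U0 U := by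
    refine integral_mono_ae (((integrable_gauge U).const_mul c).sub (integrable_const C)) hi ?_
    filter_upwards [hU] with x hx
    have h2 := (hgr (xiEnt U x) hx).1
    have h3 : 0 ≤ 1 / 2 * ‖vel U x - vel U0 x‖ ^ 2 := by positivity
    simp only [energyDensity]
    linarith
  rw [integral_sub ((integrable_gauge U).const_mul c) (integrable_const C), integral_const_mul] at h1
  simp only [integral_const, probReal_univ, one_smul] at h1
  linarith

theorem ent_midpoint_nonneg {U V : State E} (hU : ∀ᵐ x, 0 ≤ ent U x) (hV : ∀ᵐ x, 0 ≤ ent V x) :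
    ∀ᵐ x, 0 ≤ ent ((1 / 2 : ℝ) • U + (1 / 2 : ℝ) • V) x := by
  filter_upwards [hU, hV, xiEnt_comb (1 / 2) (1 / 2) U V] with x h1 h2 h3
  have h4 : ent ((1 / 2 : ℝ) • U + (1 / 2 : ℝ) • V) x = _ := congrArg Prod.snd h3
  rw [h4]
  exact midpoint_mem_energyDom (z := xiEnt U x) (z' := xiEnt V x) h1 h2

theorem integrable_defect (he : ContinuousOn e energyDom) (hg : EnergyGrowth E e)
    {U V : State E} (hU : ∀ᵐ x, 0 ≤ ent U x) (hV : ∀ᵐ x, 0 ≤ ent V x) :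
    Integrable (fun x => defect e (xiEnt U x) (xiEnt V x)) volume := by
  have hi := fun (U : State E) (hU : ∀ᵐ x, 0 ≤ ent U x) =>
    integrable_energy he hg (aestronglyMeasurable_xiEnt U) hU (integrable_gauge U)
  have := (((hi U hU).add (hi V hV)).div_const 2).sub (hi _ (ent_midpoint_nonneg hU hV))
  refine this.congr ?_
  filter_upwards [xiEnt_comb (1 / 2) (1 / 2) U V] with x hx
  simp only [Pi.sub_apply, Pi.add_apply, hx, defect]

/-- The kinetic part is exact by the parallelogram law; the internal energy contributes its defect
by definition. -/
theorem J_midpoint (he : ContinuousOn e energyDom) (hg : EnergyGrowth E e) (U0 : State E)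
    {U V : State E} (hU : ∀ᵐ x, 0 ≤ ent U x) (hV : ∀ᵐ x, 0 ≤ ent V x) :
    (J e U0 U + J e U0 V) / 2 - J e U0 ((1 / 2 : ℝ) • U + (1 / 2 : ℝ) • V)
      = 1 / 8 * ‖U.1 - V.1‖ ^ 2 + ∫ x, defect e (xiEnt U x) (xiEnt V x) := by
  have hiU := integrable_energyDensity he hg U0 hU
  have hiV := integrable_energyDensity he hg U0 hV
  have hiW := integrable_energyDensity he hg U0 (ent_midpoint_nonneg hU hV)
  have hk : Integrable (fun x => 1 / 8 * ‖vel U x - vel V x‖ ^ 2) volume :=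
    (((memLp_vel U).sub (memLp_vel V)).integrable_norm_pow two_ne_zero).const_mul _
  rw [norm_sub_sq_eq_integral, ← integral_const_mul, ← integral_add hk (integrable_defect he hg hU hV)]
  unfold J
  have hiUV : Integrable (fun x => (energyDensity e U0 U x + energyDensity e U0 V x) / 2) volume :=
    (hiU.add hiV).div_const 2
  rw [← integral_add hiU hiV, ← integral_div, ← integral_sub hiUV hiW]
  refine integral_congr_ae ?_
  filter_upwards [xiEnt_comb (1 / 2) (1 / 2) U V, vel_comb (1 / 2) (1 / 2) U V] with x h1 h2
  simp only [energyDensity, h1, h2, defect]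
  have h3 : ((1 / 2 : ℝ) • vel U x + (1 / 2 : ℝ) • vel V x) - vel U0 x
      = (1 / 2 : ℝ) • ((vel U x - vel U0 x) + (vel V x - vel U0 x)) := by module
  have h4 : vel U x - vel V x = (vel U x - vel U0 x) - (vel V x - vel U0 x) := by abel
  rw [h3, h4, norm_smul, mul_pow]
  have h5 := parallelogram_law_with_norm ℝ (vel U x - vel U0 x) (vel V x - vel U0 x)
  rw [show ‖(1 / 2 : ℝ)‖ = 1 / 2 by norm_num]
  nlinarith [h5]

/-- Admissible states whose energies are close to a lower bound are close to each other. -/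
theorem dist_almost_minimizers (he : ContinuousOn e energyDom)
    (hc : StrictConvexOn ℝ energyDom e) (hg : EnergyGrowth E e)
    (hent : ∀ U ∈ admissible e r h U0, ∀ᵐ x, 0 ≤ ent U x) {m : ℝ}
    (hm : ∀ U ∈ admissible e r h U0, m ≤ J e U0 U) {ε : ℝ} (hε : 0 < ε) :
    ∃ δ, 0 < δ ∧ ∀ U ∈ admissible e r h U0, ∀ V ∈ admissible e r h U0,
      J e U0 U ≤ m + δ → J e U0 V ≤ m + δ →
        ‖U.1 - V.1‖ < ε ∧ ‖xiEntL1 U - xiEntL1 V‖ < ε := by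
  obtain ⟨c, C, hc0, hcC⟩ := integral_gauge_le he hg
  -- By coercivity this bounds the integrated gauge of every admissible state with `J ≤ m + 1`.
  set M : ℝ := (|m| + 1 + |C|) / c with hM
  have hM0 : 0 ≤ M := by positivity
  obtain ⟨K, hK0, hK⟩ := norm_sub_le_defect (E := E) he hc
    (ε := ε / (2 * (1 + 2 * M))) (by positivity)
  -- The midpoint gap is at most `δ`. Hence `‖v - v'‖² ≤ 8δ ≤ ε²/2`, while `‖z - z'‖` in `L¹` is at
  -- most `ε/2` from the gauge term plus `ε/4` from the defect term.
  refine ⟨min 1 (min (ε ^ 2 / 16) (ε / (4 * (K + 1)))), by positivity, ?_⟩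
  intro U hU V hV hJU hJV
  set δ := min 1 (min (ε ^ 2 / 16) (ε / (4 * (K + 1)))) with hδ
  have hδ1 : δ ≤ 1 := min_le_left _ _
  have hδ2 : δ ≤ ε ^ 2 / 16 := (min_le_right _ _).trans (min_le_left _ _)
  have hδ3 : δ ≤ ε / (4 * (K + 1)) := (min_le_right _ _).trans (min_le_right _ _)
  -- The midpoint is admissible, so its energy is at least `m` and the left side of the midpoint
  -- identity is at most `δ`.
  have hW := hm _ (comb_mem_admissible hU hV (show (1 / 2 : ℝ) + 1 / 2 = 1 by norm_num))
  have hmid := J_midpoint he hg U0 (hent U hU) (hent V hV)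
  have hdi := integrable_defect he hg (hent U hU) (hent V hV)
  have hd0 : 0 ≤ ∫ x, defect e (xiEnt U x) (xiEnt V x) := by
    refine integral_nonneg_of_ae ?_
    filter_upwards [hent U hU, hent V hV] with x h1 h2
    exact defect_nonneg hc h1 h2
  have hgauge : ∀ U ∈ admissible e r h U0, J e U0 U ≤ m + δ →
      ∫ x, gauge E (xiEnt U x) ≤ M := by
    intro U hU hJ
    rw [hM, le_div_iff₀ hc0]
    have := hcC U0 U (hent U hU)
    nlinarith [le_abs_self m, le_abs_self C]
  constructor
  · refine lt_of_pow_lt_pow_left₀ 2 hε.le ?_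
    nlinarith [sq_nonneg ε, pow_pos hε 2]
  · rw [norm_xiEntL1_sub]
    have hle : ∫ x, ‖xiEnt U x - xiEnt V x‖ ≤ ∫ x, (ε / (2 * (1 + 2 * M)) *
        (1 + gauge E (xiEnt U x) + gauge E (xiEnt V x))
          + K * defect e (xiEnt U x) (xiEnt V x)) := by
      refine integral_mono_ae ((integrable_xiEnt U).sub (integrable_xiEnt V)).norm
        (((((integrable_const 1).add (integrable_gauge U)).add (integrable_gauge V)).const_mul
          _).add (hdi.const_mul K)) ?_
      filter_upwards [hent U hU, hent V hV] with x h1 h2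
      exact hK _ h1 _ h2
    have hi1 : Integrable (fun x => 1 + gauge E (xiEnt U x)) volume :=
      (integrable_const 1).add (integrable_gauge U)
    have hi2 : Integrable (fun x => 1 + gauge E (xiEnt U x) + gauge E (xiEnt V x)) volume :=
      hi1.add (integrable_gauge V)
    rw [integral_add (hi2.const_mul _) (hdi.const_mul K), integral_const_mul, integral_const_mul,
      integral_add hi1 (integrable_gauge V), integral_add (integrable_const 1) (integrable_gauge U)]
      at hle
    simp only [integral_const, probReal_univ, one_smul] at hle
    have h1 : ε / (2 * (1 + 2 * M)) * ((1 + ∫ x, gauge E (xiEnt U x)) + ∫ x, gauge E (xiEnt V x))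
        ≤ ε / 2 := by
      calc _ ≤ ε / (2 * (1 + 2 * M)) * (1 + 2 * M) := by
            refine mul_le_mul_of_nonneg_left ?_ (by positivity)
            linarith [hgauge U hU hJU, hgauge V hV hJV]
        _ = ε / 2 := by field_simp
    have h2 : K * ∫ x, defect e (xiEnt U x) (xiEnt V x) ≤ ε / 4 := by
      calc _ ≤ (K + 1) * δ := by
            refine mul_le_mul (by linarith) ?_ hd0 (by linarith)
            nlinarith [sq_nonneg ‖U.1 - V.1‖]
        _ ≤ (K + 1) * (ε / (4 * (K + 1))) := by gcongr
        _ = ε / 4 := by field_simp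
    linarith

theorem state_ext {U V : State E} (h1 : U.1 = V.1) (h2 : xiEntL1 U = xiEntL1 V) : U = V := by
  have hae : xiEnt U =ᵐ[volume] xiEnt V :=
    (coeFn_xiEntL1 U).symm.trans (h2 ▸ coeFn_xiEntL1 V)
  refine Prod.ext h1 (Prod.ext (Prod.ext ?_ (Prod.ext ?_ ?_)) ?_)
  · exact Lp.ext (hae.mono fun x hx => congrArg (fun z => z.1.1) hx)
  · exact Lp.ext (hae.mono fun x hx => congrArg (fun z => z.1.2.1) hx)
  · exact Lp.ext (hae.mono fun x hx => congrArg (fun z => z.1.2.2) hx)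
  · exact Lp.ext (hae.mono fun x hx => congrArg (fun z => z.2) hx)

theorem minimizer_unique (he : ContinuousOn e energyDom)
    (hc : StrictConvexOn ℝ energyDom e) (hg : EnergyGrowth E e)
    (hent : ∀ U ∈ admissible e r h U0, ∀ᵐ x, 0 ≤ ent U x) {U V : State E}
    (hU : IsMinimizer e r h U0 U) (hV : IsMinimizer e r h U0 V) : U = V := by
  have key : ∀ ε : ℝ, 0 < ε → ‖U.1 - V.1‖ < ε ∧ ‖xiEntL1 U - xiEntL1 V‖ < ε := by
    intro ε hε
    obtain ⟨δ, hδ, H⟩ := dist_almost_minimizers he hc hg hent (m := J e U0 U) hU.2 hε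
    exact H U hU.1 V hV.1 (by linarith) (by linarith [hV.2 U hU.1])
  refine state_ext ?_ ?_
  · rw [← sub_eq_zero, ← norm_le_zero_iff]
    exact le_of_forall_pos_lt_add fun ε hε => by simpa using (key ε hε).1
  · rw [← sub_eq_zero, ← norm_le_zero_iff]
    exact le_of_forall_pos_lt_add fun ε hε => by simpa using (key ε hε).2

/-- Lower semicontinuity: the limit of states of bounded energy is a state, of no larger energy. -/
theorem exists_state_of_tendsto (he : ContinuousOn e energyDom) (hg : EnergyGrowth E e)
    {S : ℕ → State E} (hS : ∀ n, ∀ᵐ x, 0 ≤ ent (S n) x) {m : ℝ}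
    (hJ : Tendsto (fun n => J e U0 (S n)) atTop (𝓝 m)) {v : Lp V3 2 (volume : Measure T3)}
    {z : Lp (Xi × ℝ) 1 (volume : Measure T3)} (hv : Tendsto (fun n => (S n).1) atTop (𝓝 v))
    (hz : Tendsto (fun n => xiEntL1 (S n)) atTop (𝓝 z)) :
    ∃ U : State E, U.1 = v ∧ xiEntL1 U = z ∧ J e U0 U ≤ m := by
  have hg' := hg
  obtain ⟨c, C, hc0, hgr⟩ := hg
  -- an almost everywhere convergent subsequence
  obtain ⟨a, ha, hza⟩ := (tendstoInMeasure_of_tendsto_Lp hz).exists_seq_tendsto_ae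
  obtain ⟨b, hb, hvb⟩ := (tendstoInMeasure_of_tendsto_Lp
    (hv.comp ha.tendsto_atTop)).exists_seq_tendsto_ae
  let s : ℕ → ℕ := a ∘ b
  have hs : Tendsto s atTop atTop := ha.tendsto_atTop.comp hb.tendsto_atTop
  have hza' : ∀ᵐ x, Tendsto (fun n => xiEnt (S (s n)) x) atTop (𝓝 (z x)) := by
    filter_upwards [hza, ae_all_iff.2 fun n => coeFn_xiEntL1 (S (s n))] with x h1 h2
    refine (h1.comp hb.tendsto_atTop).congr fun n => ?_
    exact h2 n
  have hzd : ∀ᵐ x, z x ∈ energyDom := by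
    filter_upwards [hza', ae_all_iff.2 fun n => hS (s n)] with x h1 h2
    exact isClosed_energyDom.mem_of_tendsto h1 (Eventually.of_forall h2)
  -- Adding the coercivity constant `C` makes the integrands nonnegative, as Fatou's lemma requires.
  let f : T3 → ℝ := fun x => 1 / 2 * ‖v x - vel U0 x‖ ^ 2 + e (z x) + C
  let F : ℕ → T3 → ℝ := fun n x => energyDensity e U0 (S (s n)) x + C
  have hF0 : ∀ n, ∀ᵐ x, 0 ≤ F n x := by
    intro n
    filter_upwards [hS (s n)] with x hx
    have h1 := (hgr (xiEnt (S (s n)) x) hx).1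
    have h2 := gauge_nonneg (E := E) (xiEnt (S (s n)) x)
    have h3 : 0 ≤ 1 / 2 * ‖vel (S (s n)) x - vel U0 x‖ ^ 2 := by positivity
    simp only [F, energyDensity]
    nlinarith [mul_nonneg hc0.le h2]
  have hFi : ∀ n, Integrable (F n) volume := fun n =>
    (integrable_energyDensity he hg' U0 (hS (s n))).add (integrable_const C)
  have hFint : ∀ n, ∫ x, F n x = J e U0 (S (s n)) + C := by
    intro n
    rw [integral_add (integrable_energyDensity he hg' U0 (hS (s n))) (integrable_const C)]
    simp [J]
  have hfm : AEStronglyMeasurable f volume := by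
    have h1 : AEStronglyMeasurable (fun x => e (z x)) volume := by
      refine ((continuous_comp_clamp he).comp_aestronglyMeasurable
        (Lp.aestronglyMeasurable z)).congr ?_
      filter_upwards [hzd] with x hx
      rw [clamp_of_mem hx]
    exact ((((((Lp.aestronglyMeasurable v).sub (memLp_vel U0).1).norm.pow 2).const_mul _).add
      h1).add aestronglyMeasurable_const)
  have hlim : ∀ᵐ x, Tendsto (fun n => F n x) atTop (𝓝 (f x)) := by
    filter_upwards [hza', hvb, hzd, ae_all_iff.2 fun n => hS (s n)] with x h1 h2 h3 h4
    refine Tendsto.add (Tendsto.add ?_ ?_) tendsto_const_nhds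
    · exact (((h2.sub_const _).norm.pow 2).const_mul _)
    · have := (he _ h3).tendsto.comp (tendsto_nhdsWithin_iff.2 ⟨h1, Eventually.of_forall h4⟩)
      exact this
  have hf0 : ∀ᵐ x, 0 ≤ f x := by
    filter_upwards [hlim, ae_all_iff.2 hF0] with x h1 h2
    exact ge_of_tendsto' h1 h2
  have hfatou : ∫⁻ x, ENNReal.ofReal (f x) ≤ ENNReal.ofReal (m + C) := by
    calc ∫⁻ x, ENNReal.ofReal (f x)
        = ∫⁻ x, liminf (fun n => ENNReal.ofReal (F n x)) atTop := by
          refine lintegral_congr_ae ?_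
          filter_upwards [hlim] with x hx
          exact ((ENNReal.continuous_ofReal.tendsto _).comp hx).liminf_eq.symm
      _ ≤ liminf (fun n => ∫⁻ x, ENNReal.ofReal (F n x)) atTop :=
          lintegral_liminf_le' fun n => (hFi n).1.aemeasurable.ennreal_ofReal
      _ = ENNReal.ofReal (m + C) := by
          refine Tendsto.liminf_eq ?_
          have h1 : ∀ n, ∫⁻ x, ENNReal.ofReal (F n x)
              = ENNReal.ofReal (J e U0 (S (s n)) + C) := fun n => by
            rw [← hFint, ofReal_integral_eq_lintegral_ofReal (hFi n) (hF0 n)]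
          simp_rw [h1]
          exact (ENNReal.continuous_ofReal.tendsto _).comp ((hJ.comp hs).add_const C)
  have hfi : Integrable f volume := by
    refine ⟨hfm, ?_⟩
    rw [hasFiniteIntegral_iff_ofReal hf0]
    exact hfatou.trans_lt ENNReal.ofReal_lt_top
  have hmC : 0 ≤ m + C := by
    refine ge_of_tendsto' ((hJ.comp hs).add_const C) fun n => ?_
    have := integral_nonneg_of_ae (hF0 n)
    rwa [hFint] at this
  have hfle : ∫ x, f x ≤ m + C := by
    rw [integral_eq_lintegral_of_nonneg_ae hf0 hfm]
    exact ENNReal.toReal_le_of_le_ofReal hmC hfatou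
  -- the components of the limit
  have hgf : ∀ᵐ x, gauge E (z x) ≤ c⁻¹ * f x := by
    filter_upwards [hzd] with x hx
    rw [inv_mul_eq_div, le_div_iff₀ hc0]
    have h1 := (hgr _ hx).1
    have h2 : 0 ≤ 1 / 2 * ‖v x - vel U0 x‖ ^ 2 := by positivity
    simp only [f]
    linarith
  have hzm := Lp.aestronglyMeasurable z
  have hz1 := hzm.fst.fst
  have hz2 := hzm.fst.snd.fst
  have hz3 := hzm.fst.snd.snd
  have hz4 := hzm.snd
  -- So far `z` is only in `L¹`. Coercivity at the limit makes its gauge integrable, which gives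
  -- each component its own Lebesgue exponent.
  have hcomp : ∀ {V : Type} [NormedAddCommGroup V] (k : T3 → V) (p : ℝ), 1 ≤ p →
      AEStronglyMeasurable k volume → (∀ x, ‖k x‖ ^ p ≤ gauge E (z x)) →
      MemLp k (ENNReal.ofReal p) volume := by
    intro V _ k p hp hk hle
    refine memLp_of_integrable_rpow hp hk ((hfi.const_mul c⁻¹).mono'
      (hk.norm.aemeasurable.pow_const p).aestronglyMeasurable ?_)
    filter_upwards [hgf] with x hx
    rw [Real.norm_of_nonneg (by positivity)]
    exact (hle x).trans hx
  have n1 : ∀ x, 0 ≤ ‖(z x).1.1‖ ^ E.p := fun x => by positivity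
  have n2 : ∀ x, 0 ≤ ‖(z x).1.2.1‖ ^ E.q := fun x => by positivity
  have n3 : ∀ x, 0 ≤ ‖(z x).1.2.2‖ ^ E.ρ := fun x => by positivity
  have n4 : ∀ x, 0 ≤ ‖(z x).2‖ ^ E.l := fun x => by positivity
  have hgz : ∀ x, gauge E (z x) = ‖(z x).1.1‖ ^ E.p + ‖(z x).1.2.1‖ ^ E.q
      + ‖(z x).1.2.2‖ ^ E.ρ + ‖(z x).2‖ ^ E.l := fun x => rfl
  have m1 := hcomp (fun x => (z x).1.1) E.p E.one_le_p' hz1 fun x => by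
    rw [hgz]; linarith [n2 x, n3 x, n4 x]
  have m2 := hcomp (fun x => (z x).1.2.1) E.q E.one_le_q' hz2 fun x => by
    rw [hgz]; linarith [n1 x, n3 x, n4 x]
  have m3 := hcomp (fun x => (z x).1.2.2) E.ρ E.one_lt_ρ.le hz3 fun x => by
    rw [hgz]; linarith [n1 x, n2 x, n4 x]
  have m4 := hcomp (fun x => (z x).2) E.l E.one_lt_l.le hz4 fun x => by
    rw [hgz]; linarith [n1 x, n2 x, n3 x]
  let U : State E := (v, (m1.toLp _, m2.toLp _, m3.toLp _), m4.toLp _)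
  have hUz : xiEnt U =ᵐ[volume] z := by
    filter_upwards [m1.coeFn_toLp, m2.coeFn_toLp, m3.coeFn_toLp, m4.coeFn_toLp] with x h1 h2 h3 h4
    exact Prod.ext (Prod.ext h1 (Prod.ext h2 h3)) h4
  refine ⟨U, rfl, Lp.ext ((coeFn_xiEntL1 U).trans hUz), ?_⟩
  have hJU : ∫ x, f x = J e U0 U + C := by
    have h1 : f =ᵐ[volume] fun x => energyDensity e U0 U x + C := by
      filter_upwards [hUz] with x hx
      simp only [f, energyDensity, hx]; rfl
    have h2 : Integrable (energyDensity e U0 U) volume :=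
      ((hfi.sub (integrable_const C)).congr (by
        filter_upwards [h1] with x hx
        rw [Pi.sub_apply, hx]; ring))
    rw [integral_congr_ae h1, integral_add h2 (integrable_const C)]
    simp [J]
  linarith

/-- The direct method with strong convergence: the almost-minimizer estimate makes a minimizing
sequence Cauchy in `L² × L¹`, so completeness takes the place of weak compactness. -/
theorem exists_minimizer (he : ContinuousOn e energyDom)
    (hc : StrictConvexOn ℝ energyDom e) (hg : EnergyGrowth E e)
    (hent : ∀ U ∈ admissible e r h U0, ∀ᵐ x, 0 ≤ ent U x)
    (hne : (admissible e r h U0).Nonempty) : ∃ U, IsMinimizer e r h U0 U := by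
  obtain ⟨c, C, hc0, hcC⟩ := integral_gauge_le he hg
  have hbdd : BddBelow (J e U0 '' admissible e r h U0) := by
    refine ⟨-C, ?_⟩
    rintro _ ⟨U, hU, rfl⟩
    have h1 := hcC U0 U (hent U hU)
    have h2 : 0 ≤ ∫ x, gauge E (xiEnt U x) := integral_nonneg fun x => gauge_nonneg _
    nlinarith [mul_nonneg hc0.le h2]
  set m := sInf (J e U0 '' admissible e r h U0) with hm
  have hlow : ∀ U ∈ admissible e r h U0, m ≤ J e U0 U := fun U hU =>
    csInf_le hbdd ⟨U, hU, rfl⟩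
  have hseq : ∀ n : ℕ, ∃ U ∈ admissible e r h U0, J e U0 U < m + 1 / ((n : ℝ) + 1) := by
    intro n
    obtain ⟨_, ⟨U, hU, rfl⟩, hlt⟩ := exists_lt_of_csInf_lt (hne.image (J e U0))
      (lt_add_of_pos_right m (by positivity : (0 : ℝ) < 1 / ((n : ℝ) + 1)))
    exact ⟨U, hU, hlt⟩
  choose S hS hSJ using hseq
  have hJ : Tendsto (fun n => J e U0 (S n)) atTop (𝓝 m) := by
    refine tendsto_of_tendsto_of_tendsto_of_le_of_le tendsto_const_nhds ?_
      (fun n => hlow _ (hS n)) fun n => (hSJ n).le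
    simpa using tendsto_one_div_add_atTop_nhds_zero_nat.const_add m
  have hcauchy : ∀ ε : ℝ, 0 < ε → ∃ N, ∀ n ≥ N, ∀ k ≥ N,
      ‖(S n).1 - (S k).1‖ < ε ∧ ‖xiEntL1 (S n) - xiEntL1 (S k)‖ < ε := by
    intro ε hε
    obtain ⟨δ, hδ, H⟩ := dist_almost_minimizers he hc hg hent hlow hε
    obtain ⟨N, hN⟩ := eventually_atTop.1 (hJ.eventually_le_const (show m < m + δ by linarith))
    exact ⟨N, fun n hn k hk => H _ (hS n) _ (hS k) (hN n hn) (hN k hk)⟩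
  obtain ⟨v, hv⟩ := cauchySeq_tendsto_of_complete (u := fun n => (S n).1)
    (Metric.cauchySeq_iff.2 fun ε hε => by
      obtain ⟨N, hN⟩ := hcauchy ε hε
      exact ⟨N, fun n hn k hk => by rw [dist_eq_norm]; exact (hN n hn k hk).1⟩)
  obtain ⟨z, hz⟩ := cauchySeq_tendsto_of_complete (u := fun n => xiEntL1 (S n))
    (Metric.cauchySeq_iff.2 fun ε hε => by
      obtain ⟨N, hN⟩ := hcauchy ε hε
      exact ⟨N, fun n hn k hk => by rw [dist_eq_norm]; exact (hN n hn k hk).2⟩)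
  obtain ⟨U, rfl, rfl, hUJ⟩ := exists_state_of_tendsto he hg (fun n => hent _ (hS n)) hJ hv hz
  exact ⟨U, mem_admissible_of_tendsto hS hv hz, fun V hV => hUJ.trans (hlow V hV)⟩

/-- The state with `v = 0`, `ξ = ξ⁰` and the updated entropy is admissible. -/
theorem admissible_nonempty (hh : h ≠ 0)
    (hr : MemLp (fun x => r x / theta e (xiEnt U0 x)) (ENNReal.ofReal E.l) volume) :
    (admissible e r h U0).Nonempty := by
  refine ⟨(0, U0.2.1, U0.2.2 + h • hr.toLp _), fun B φ hφ => ?_, fun φ hφ => ?_⟩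
  · have h1 : ∀ᵐ x, ∑ i, ∑ α, dPhi B i α (defGrad U0 x) *
        vel ((0, U0.2.1, U0.2.2 + h • hr.toLp _) : State E) x i * pd α φ x = 0 := by
      filter_upwards [Lp.coeFn_zero V3 2 (volume : Measure T3)] with x hx
      have : vel ((0, U0.2.1, U0.2.2 + h • hr.toLp _) : State E) x = 0 := hx
      simp [this]
    rw [integral_congr_ae h1]
    simp [xi]
  · refine integral_congr_ae ?_
    filter_upwards [Lp.coeFn_add U0.2.2 (h • hr.toLp _), Lp.coeFn_smul h (hr.toLp _),
      hr.coeFn_toLp] with x h1 h2 h3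
    have h4 : ent ((0, U0.2.1, U0.2.2 + h • hr.toLp _) : State E) x
        = ent U0 x + h * (r x / theta e (xiEnt U0 x)) := by
      change (U0.2.2 + h • hr.toLp _ : Lp ℝ _ (volume : Measure T3)) x = _
      rw [h1, Pi.add_apply, h2, Pi.smul_apply, h3]; rfl
    rw [h4]; field_simp; ring

end Minimizer

/-! ### Derivatives of the energy -/

theorem uniqueDiffOn_energyDom : UniqueDiffOn ℝ energyDom := by
  have : energyDom = (Set.univ : Set Xi) ×ˢ Set.Ici (0 : ℝ) := by
    ext z; simp [energyDom]
  rw [this]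
  exact uniqueDiffOn_univ.prod (uniqueDiffOn_Ici 0)

theorem add_smul_mem_energyDom {z : Xi × ℝ} (hz : z ∈ energyDom) (d : Xi) (t : ℝ) :
    z + t • ((d, 0) : Xi × ℝ) ∈ energyDom := by
  change 0 ≤ z.2 + t * 0
  rw [mul_zero, add_zero]; exact hz

/-- A direction `(d, 0)` leaves the entropy unchanged, so the whole line stays in the domain and the
derivative is two-sided even where `η = 0`. -/
theorem hasDerivAt_energy_line {e : Xi × ℝ → ℝ} (he : ContDiffOn ℝ 3 e energyDom) {z : Xi × ℝ}
    (hz : z ∈ energyDom) (d : Xi) (t : ℝ) :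
    HasDerivAt (fun t : ℝ => e (z + t • ((d, 0) : Xi × ℝ)))
      (fderivWithin ℝ e energyDom (z + t • ((d, 0) : Xi × ℝ)) (d, 0)) t := by
  have h1 : HasFDerivWithinAt e (fderivWithin ℝ e energyDom (z + t • ((d, 0) : Xi × ℝ))) energyDom
      (z + t • ((d, 0) : Xi × ℝ)) :=
    (he.differentiableOn (by simp) _ (add_smul_mem_energyDom hz d t)).hasFDerivWithinAt
  have h2 : HasDerivAt (fun t : ℝ => z + t • ((d, 0) : Xi × ℝ)) ((d, 0) : Xi × ℝ) t := by
    simpa using ((hasDerivAt_id t).smul_const ((d, 0) : Xi × ℝ)).const_add z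
  rw [← hasDerivWithinAt_univ] at h2 ⊢
  exact h1.comp_hasDerivWithinAt t h2 fun s _ => add_smul_mem_energyDom hz d s

theorem sum_comp_smul_unitVec (d : Xi) : ∑ B, comp d B • unitVec B = d := by
  have h1 : ∀ F : M3, ∑ a, F a • (EuclideanSpace.single a (1 : ℝ) : M3) = F := by
    intro F; ext b
    simp [Finset.sum_apply, Pi.single_apply]
  simp only [Fintype.sum_sum_type, comp, unitVec, Finset.univ_unique, Finset.sum_singleton,
    Prod.smul_mk, smul_zero]
  have h2 : ∑ a, ((d.1 a • (EuclideanSpace.single a (1 : ℝ) : M3), (0 : M3), (0 : ℝ)) : Xi)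
      = (d.1, 0, 0) := by
    refine Prod.ext ?_ (Prod.ext ?_ ?_)
    · rw [Prod.fst_sum]; exact h1 d.1
    · rw [Prod.snd_sum, Prod.fst_sum]; simp
    · rw [Prod.snd_sum, Prod.snd_sum]; simp
  have h3 : ∑ a, (((0 : M3), d.2.1 a • (EuclideanSpace.single a (1 : ℝ) : M3), (0 : ℝ)) : Xi)
      = (0, d.2.1, 0) := by
    refine Prod.ext ?_ (Prod.ext ?_ ?_)
    · rw [Prod.fst_sum]; simp
    · rw [Prod.snd_sum, Prod.fst_sum]; exact h1 d.2.1
    · rw [Prod.snd_sum, Prod.snd_sum]; simp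
  rw [h2, h3]
  refine Prod.ext ?_ (Prod.ext ?_ ?_) <;> simp

theorem fderivWithin_energy_apply (e : Xi × ℝ → ℝ) (z : Xi × ℝ) (d : Xi) :
    fderivWithin ℝ e energyDom z (d, 0) = ∑ B, comp d B * dXi e B z := by
  have h : ((d, 0) : Xi × ℝ) = ∑ B, comp d B • ((unitVec B, 0) : Xi × ℝ) := by
    refine Prod.ext ?_ ?_
    · rw [Prod.fst_sum]; exact (sum_comp_smul_unitVec d).symm
    · rw [Prod.snd_sum]; simp
  rw [h, map_sum]
  exact Finset.sum_congr rfl fun B _ => by rw [map_smul, smul_eq_mul]; rfl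

theorem aestronglyMeasurable_dXi {e : Xi × ℝ → ℝ} (he : ContDiffOn ℝ 3 e energyDom) (B : Idx)
    {U : State E} (hU : ∀ᵐ x, 0 ≤ ent U x) :
    AEStronglyMeasurable (fun x => dXi e B (xiEnt U x)) volume := by
  have h1 : ContinuousOn (dXi e B) energyDom :=
    (he.continuousOn_fderivWithin uniqueDiffOn_energyDom (by simp)).clm_apply continuousOn_const
  refine ((continuous_comp_clamp h1).comp_aestronglyMeasurable
    (aestronglyMeasurable_xiEnt U)).congr ?_
  filter_upwards [hU] with x hx
  rw [clamp_of_mem hx]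

/-! ### The growth of the derivatives restricts the exponents -/

/-- The derivative is at most of order `t^{s/ν}`, so by the mean value theorem `g` grows at most
like `t^{1 + s/ν}`, while it is bounded below by a multiple of `t^s`. -/
theorem exponent_le_of_deriv_growth {g g' : ℝ → ℝ} (hg : ∀ t, HasDerivAt g (g' t) t)
    {s ν c C C' : ℝ} (hs : 0 < s) (hν : 0 < ν) (hc : 0 < c)
    (hlow : ∀ t, 0 ≤ t → c * t ^ s - C' ≤ g t)
    (hder : ∀ t, 0 ≤ t → |g' t| ^ ν ≤ C * t ^ s + C) : s ≤ 1 + s / ν := by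
  by_contra hlt
  rw [not_le] at hlt
  set b := 1 + s / ν with hb
  set K := (2 * |C|) ^ (1 / ν) with hK
  have hK0 : 0 ≤ K := by positivity
  have hup : ∀ t, 1 ≤ t → g t ≤ g 0 + K * t ^ b := by
    intro t ht
    have ht0 : 0 < t := by linarith
    obtain ⟨u, ⟨hu0, hut⟩, hu⟩ := exists_hasDerivAt_eq_slope g g' ht0
      (fun x _ => (hg x).continuousAt.continuousWithinAt) fun x _ => hg x
    have h1 : g t - g 0 = g' u * t := by
      rw [hu, sub_zero]; field_simp
    have h2 : |g' u| ^ ν ≤ 2 * |C| * t ^ s := by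
      have h3 : u ^ s ≤ t ^ s := Real.rpow_le_rpow hu0.le hut.le hs.le
      have h4 : 1 ≤ t ^ s := Real.one_le_rpow ht hs.le
      have h5 : 0 ≤ u ^ s := by positivity
      calc |g' u| ^ ν ≤ C * u ^ s + C := hder u hu0.le
        _ ≤ |C| * u ^ s + |C| := by gcongr <;> exact le_abs_self C
        _ ≤ |C| * t ^ s + |C| * t ^ s := by
            gcongr
            exact le_mul_of_one_le_right (abs_nonneg C) h4
        _ = 2 * |C| * t ^ s := by ring
    have h6 : |g' u| ≤ K * t ^ (s / ν) := by
      have h7 := Real.rpow_le_rpow (by positivity) h2 (by positivity : 0 ≤ 1 / ν)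
      rw [← Real.rpow_mul (abs_nonneg _), mul_one_div_cancel hν.ne', Real.rpow_one,
        Real.mul_rpow (by positivity) (by positivity), ← Real.rpow_mul ht0.le] at h7
      rwa [mul_one_div] at h7
    have h8 : t ^ b = t ^ (s / ν) * t := by
      rw [hb, add_comm, Real.rpow_add_one ht0.ne']
    have h9 : g' u * t ≤ K * t ^ (s / ν) * t := by
      gcongr; exact (le_abs_self _).trans h6
    rw [h8, ← mul_assoc]; linarith
  obtain ⟨t, ht, ht1⟩ := (((tendsto_rpow_atTop (sub_pos.2 hlt)).eventually_gt_atTop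
    ((|C' + g 0| + K) / c)).and (eventually_ge_atTop 1)).exists
  have ht0 : 0 < t := by linarith
  rw [div_lt_iff₀ hc] at ht
  have hb1 : 1 ≤ t ^ b := Real.one_le_rpow ht1 (by rw [hb]; positivity)
  have h1 : t ^ s = t ^ (s - b) * t ^ b := by
    rw [← Real.rpow_add ht0]; ring_nf
  have h2 := hlow t ht0.le
  have h3 := hup t ht1
  have h4 : (|C' + g 0| + K) * t ^ b < t ^ (s - b) * c * t ^ b := by gcongr
  have h5 : |C' + g 0| ≤ |C' + g 0| * t ^ b := le_mul_of_one_le_right (abs_nonneg _) hb1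
  rw [h1] at h2
  nlinarith [le_abs_self (C' + g 0)]

theorem abs_dXi_inl_le (e : Xi × ℝ → ℝ) (a : Fin 3 × Fin 3) (z : Xi × ℝ) :
    |dXi e (Sum.inl a) z| ≤ ‖dF e z‖ := PiLp.norm_apply_le (dF e z) a

theorem abs_dXi_inr_inl_le (e : Xi × ℝ → ℝ) (a : Fin 3 × Fin 3) (z : Xi × ℝ) :
    |dXi e (Sum.inr (Sum.inl a)) z| ≤ ‖dZeta e z‖ := PiLp.norm_apply_le (dZeta e z) a

/-- Along a ray in a `ζ`-direction the comparison with `ν = p/(p-2)` reads `q ≤ 1 + q(p-2)/p`. This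
makes the variations used for the Euler–Lagrange equation elements of `L^q`. -/
theorem two_mul_q_le {e : Xi × ℝ → ℝ} (he : ContDiffOn ℝ 3 e energyDom) (hg : EnergyGrowth E e)
    (hd : DerivGrowth E e) : 2 * E.q ≤ E.p := by
  have hp := E.four_le_p
  have hq := E.two_le_q
  obtain ⟨c, C', hc, hgr⟩ := hg
  obtain ⟨C, hC⟩ := hd
  have h0 : (0 : Xi × ℝ) ∈ energyDom := le_refl (0 : ℝ)
  have hgauge : ∀ t : ℝ, 0 ≤ t → gauge E (0 + t • ((unitVec (Sum.inr (Sum.inl (0, 0))), 0) : Xi × ℝ))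
      = t ^ E.q := by
    intro t ht
    simp [gauge, unitVec, norm_smul, abs_of_nonneg ht, Real.zero_rpow (by linarith : E.p ≠ 0),
      Real.zero_rpow (by linarith [E.one_lt_ρ] : E.ρ ≠ 0),
      Real.zero_rpow (by linarith [E.one_lt_l] : E.l ≠ 0)]
  have key := exponent_le_of_deriv_growth (s := E.q) (ν := E.p / (E.p - 2)) (c := c) (C := C)
    (C' := C') (fun t => hasDerivAt_energy_line he h0 (unitVec (Sum.inr (Sum.inl (0, 0)))) t)
    (by linarith) (div_pos (by linarith) (by linarith)) hc
    (fun t ht => by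
      have := (hgr _ (add_smul_mem_energyDom h0 (unitVec (Sum.inr (Sum.inl (0, 0)))) t)).1
      rwa [hgauge t ht] at this)
    (fun t ht => by
      have := hC _ (add_smul_mem_energyDom h0 (unitVec (Sum.inr (Sum.inl (0, 0)))) t)
      rw [hgauge t ht] at this
      refine le_trans ?_ this
      refine le_trans (Real.rpow_le_rpow (abs_nonneg _) (abs_dXi_inr_inl_le e (0, 0) _)
        (div_nonneg (by linarith) (by linarith))) ?_
      have n1 : ∀ z, 0 ≤ ‖dF e z‖ ^ (E.p / (E.p - 1)) := fun z => by positivity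
      have n2 : ∀ z, 0 ≤ |dW e z| ^ (E.p / (E.p - 3)) := fun z => by positivity
      linarith [n1 (0 + t • ((unitVec (Sum.inr (Sum.inl (0, 0))), 0) : Xi × ℝ)),
        n2 (0 + t • ((unitVec (Sum.inr (Sum.inl (0, 0))), 0) : Xi × ℝ))])
  have hp0 : 0 < E.p := by linarith
  rw [div_div_eq_mul_div, ← sub_le_iff_le_add', le_div_iff₀ hp0] at key
  linarith

/-- The same comparison along a ray in the `w`-direction, with `ν = p/(p-3)`: `ρ ≤ 1 + ρ(p-3)/p`. -/
theorem three_mul_ρ_le {e : Xi × ℝ → ℝ} (he : ContDiffOn ℝ 3 e energyDom) (hg : EnergyGrowth E e)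
    (hd : DerivGrowth E e) : 3 * E.ρ ≤ E.p := by
  have hp := E.four_le_p
  have hρ := E.one_lt_ρ
  obtain ⟨c, C', hc, hgr⟩ := hg
  obtain ⟨C, hC⟩ := hd
  have h0 : (0 : Xi × ℝ) ∈ energyDom := le_refl (0 : ℝ)
  have hgauge : ∀ t : ℝ, 0 ≤ t → gauge E (0 + t • ((unitVec (Sum.inr (Sum.inr ())), 0) : Xi × ℝ))
      = t ^ E.ρ := by
    intro t ht
    simp [gauge, unitVec, abs_of_nonneg ht, Real.zero_rpow (by linarith : E.p ≠ 0),
      Real.zero_rpow (by linarith [E.two_le_q] : E.q ≠ 0),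
      Real.zero_rpow (by linarith [E.one_lt_l] : E.l ≠ 0)]
  have key := exponent_le_of_deriv_growth (s := E.ρ) (ν := E.p / (E.p - 3)) (c := c) (C := C)
    (C' := C') (fun t => hasDerivAt_energy_line he h0 (unitVec (Sum.inr (Sum.inr ()))) t)
    (by linarith) (div_pos (by linarith) (by linarith)) hc
    (fun t ht => by
      have := (hgr _ (add_smul_mem_energyDom h0 (unitVec (Sum.inr (Sum.inr ()))) t)).1
      rwa [hgauge t ht] at this)
    (fun t ht => by
      have := hC _ (add_smul_mem_energyDom h0 (unitVec (Sum.inr (Sum.inr ()))) t)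
      rw [hgauge t ht] at this
      refine le_trans ?_ this
      change |dW e _| ^ _ ≤ _
      have n1 : ∀ z, 0 ≤ ‖dF e z‖ ^ (E.p / (E.p - 1)) := fun z => by positivity
      have n2 : ∀ z, 0 ≤ ‖dZeta e z‖ ^ (E.p / (E.p - 2)) := fun z => by positivity
      linarith [n1 (0 + t • ((unitVec (Sum.inr (Sum.inr ())), 0) : Xi × ℝ)),
        n2 (0 + t • ((unitVec (Sum.inr (Sum.inr ())), 0) : Xi × ℝ))])
  have hp0 : 0 < E.p := by linarith
  rw [div_div_eq_mul_div, ← sub_le_iff_le_add', le_div_iff₀ hp0] at key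
  linarith

/-! ### Integrability of the stress -/

theorem memLp_dXi {e : Xi × ℝ → ℝ} (he : ContDiffOn ℝ 3 e energyDom) (B : Idx) {U : State E}
    (hU : ∀ᵐ x, 0 ≤ ent U x) {ν C : ℝ} (hν : 1 ≤ ν)
    (hle : ∀ z ∈ energyDom, |dXi e B z| ^ ν ≤ C * gauge E z + C) :
    MemLp (fun x => dXi e B (xiEnt U x)) (ENNReal.ofReal ν) volume := by
  have hm := aestronglyMeasurable_dXi he B hU
  refine memLp_of_integrable_rpow hν hm ((((integrable_gauge U).const_mul C).add
    (integrable_const C)).mono' (hm.norm.aemeasurable.pow_const ν).aestronglyMeasurable ?_)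
  filter_upwards [hU] with x hx
  rw [Real.norm_of_nonneg (by positivity)]
  exact hle _ hx

theorem integrable_mul_of_conj {f g : T3 → ℝ} {a b : ℝ} (hab : a.HolderConjugate b)
    (hf : MemLp f (ENNReal.ofReal a) volume) (hg : MemLp g (ENNReal.ofReal b) volume) :
    Integrable (fun x => f x * g x) volume := by
  have : ENNReal.HolderConjugate (ENNReal.ofReal a) (ENNReal.ofReal b) := hab.ennrealOfReal
  exact hf.integrable_mul hg

theorem holderConjugate_div {p k : ℝ} (hk : 0 < k) (hkp : k < p) :
    (p / (p - k)).HolderConjugate (p / k) := by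
  have h1 : 0 < p - k := by linarith
  have h2 : 0 < p := by linarith
  refine Real.holderConjugate_iff.2 ⟨?_, ?_⟩
  · rw [lt_div_iff₀ h1]; linarith
  · field_simp; ring

/-- Hölder's inequality with the conjugate pairs `p/(p-k)` and `p/k` for `k = 1, 2, 3`. The
coefficients `∂Φ/∂F(F⁰)` are respectively bounded, in `L^p` and in `L^{p/2}`, which is more than
`L^{p/k}` requires. -/
theorem integrable_stress {e : Xi × ℝ → ℝ} (he : ContDiffOn ℝ 3 e energyDom)
    (hd : DerivGrowth E e) (U0 : State E) {U : State E} (hU : ∀ᵐ x, 0 ≤ ent U x) (i α : Fin 3) :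
    Integrable (stress e U0 U i α) volume := by
  have hp := E.four_le_p
  obtain ⟨C, hC⟩ := hd
  have n1 : ∀ z, 0 ≤ ‖dF e z‖ ^ (E.p / (E.p - 1)) := fun z => by positivity
  have n2 : ∀ z, 0 ≤ ‖dZeta e z‖ ^ (E.p / (E.p - 2)) := fun z => by positivity
  have n3 : ∀ z, 0 ≤ |dW e z| ^ (E.p / (E.p - 3)) := fun z => by positivity
  have hone : ∀ k : ℝ, 0 < k → k ≤ 3 → 1 ≤ E.p / (E.p - k) := fun k h0 hk => by
    rw [one_le_div (by linarith)]; linarith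
  have hnn : ∀ k : ℝ, 0 < k → k ≤ 3 → 0 ≤ E.p / (E.p - k) := fun k h0 hk =>
    zero_le_one.trans (hone k h0 hk)
  refine integrable_finsetSum _ fun B _ => ?_
  rcases B with a | a | u
  · refine integrable_mul_of_conj (holderConjugate_div (k := 1) one_pos (by linarith))
      (memLp_dXi he _ hU (C := C) (hone 1 one_pos (by norm_num)) fun z hz => ?_)
      (memLp_dPhi_inl U0 a i α _)
    have := Real.rpow_le_rpow (abs_nonneg _) (abs_dXi_inl_le e a z)
      (hnn 1 one_pos (by norm_num))
    linarith [hC z hz, n2 z, n3 z]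
  · refine integrable_mul_of_conj (holderConjugate_div (k := 2) two_pos (by linarith))
      (memLp_dXi he _ hU (C := C) (hone 2 two_pos (by norm_num)) fun z hz => ?_)
      ((memLp_dPhi_cof U0 a i α).mono_exponent (ENNReal.ofReal_le_ofReal (by linarith)))
    have := Real.rpow_le_rpow (abs_nonneg _) (abs_dXi_inr_inl_le e a z)
      (hnn 2 two_pos (by norm_num))
    linarith [hC z hz, n1 z, n3 z]
  · refine integrable_mul_of_conj (holderConjugate_div (k := 3) three_pos (by linarith))
      (memLp_dXi he _ hU (C := C) (hone 3 three_pos le_rfl) fun z hz => ?_)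
      ((memLp_dPhi_det U0 u i α).mono_exponent (ENNReal.ofReal_le_ofReal (by linarith)))
    change |dW e z| ^ _ ≤ _
    linarith [hC z hz, n1 z, n2 z]

/-! ### The first variation of the energy -/

/-- Difference quotients of a convex function are monotone in the step, so for `0 < t ≤ 1` the
quotient lies between those at `-1` and `1`. -/
theorem abs_quotient_le_of_convex {e : Xi × ℝ → ℝ} (hc : StrictConvexOn ℝ energyDom e) {z : Xi × ℝ}
    (hz : z ∈ energyDom) (d : Xi) {t : ℝ} (ht0 : 0 < t) (ht1 : t ≤ 1) :
    |t⁻¹ * (e (z + t • ((d, 0) : Xi × ℝ)) - e z)|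
      ≤ |e (z + (1 : ℝ) • ((d, 0) : Xi × ℝ)) - e z|
        + |e z - e (z + (-1 : ℝ) • ((d, 0) : Xi × ℝ))| := by
  set D : Xi × ℝ := (d, 0) with hD
  have m := fun s : ℝ => add_smul_mem_energyDom hz d s
  rw [← hD] at m
  have h1 := hc.convexOn.2 hz (m 1) (sub_nonneg.2 ht1) ht0.le (by ring)
  have e1 : (1 - t) • z + t • (z + (1 : ℝ) • D) = z + t • D := by module
  rw [e1, smul_eq_mul, smul_eq_mul] at h1
  -- These weights express `z` as a convex combination of `z + tD` and `z - D`.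
  have h2 := hc.convexOn.2 (m t) (m (-1)) (by positivity : 0 ≤ 1 / (1 + t))
    (by positivity : 0 ≤ t / (1 + t)) (by field_simp)
  have e2 : (1 / (1 + t)) • (z + t • D) + (t / (1 + t)) • (z + (-1 : ℝ) • D) = z := by
    have h3 : t / (1 + t) = t * (1 / (1 + t)) := by ring
    have h4 : (1 / (1 + t)) + t * (1 / (1 + t)) = 1 := by field_simp
    rw [h3]
    calc _ = ((1 / (1 + t)) + t * (1 / (1 + t))) • z := by module
      _ = z := by rw [h4, one_smul]
  rw [e2, smul_eq_mul, smul_eq_mul, div_mul_eq_mul_div, div_mul_eq_mul_div, ← add_div,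
    le_div_iff₀ (by positivity)] at h2
  have h3 : t⁻¹ * (e (z + t • D) - e z) ≤ e (z + (1 : ℝ) • D) - e z := by
    rw [inv_mul_le_iff₀ ht0]; linarith
  have h4 : e z - e (z + (-1 : ℝ) • D) ≤ t⁻¹ * (e (z + t • D) - e z) := by
    rw [le_inv_mul_iff₀ ht0]; linarith
  rw [abs_le]
  constructor
  · linarith [neg_abs_le (e z - e (z + (-1 : ℝ) • D)), abs_nonneg (e (z + (1 : ℝ) • D) - e z)]
  · linarith [le_abs_self (e (z + (1 : ℝ) • D) - e z), abs_nonneg (e z - e (z + (-1 : ℝ) • D))]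

/-- Dominated convergence with the convexity bound: the dominating function involves only the energy
at `z` and `z ± (d, 0)`, so no estimate of the derivative is needed. -/
theorem tendsto_integral_quotient {e : Xi × ℝ → ℝ} (he : ContDiffOn ℝ 3 e energyDom)
    (hc : StrictConvexOn ℝ energyDom e) {z : T3 → Xi × ℝ} {d : T3 → Xi}
    (hzd : ∀ᵐ x, z x ∈ energyDom)
    (hi : ∀ t : ℝ, Integrable (fun x => e (z x + t • ((d x, 0) : Xi × ℝ))) volume) :
    Tendsto (fun n : ℕ => ∫ x, (1 / ((n : ℝ) + 1))⁻¹ *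
        (e (z x + (1 / ((n : ℝ) + 1)) • ((d x, 0) : Xi × ℝ)) - e (z x))) atTop
      (𝓝 (∫ x, fderivWithin ℝ e energyDom (z x) (d x, 0))) := by
  have hi0 : Integrable (fun x => e (z x)) volume := by simpa using hi 0
  refine tendsto_integral_of_dominated_convergence
    (fun x => |e (z x + (1 : ℝ) • ((d x, 0) : Xi × ℝ)) - e (z x)|
      + |e (z x) - e (z x + (-1 : ℝ) • ((d x, 0) : Xi × ℝ))|)
    (fun n => (((hi _).sub hi0).const_mul _).1)
    (((hi 1).sub hi0).abs.add (hi0.sub (hi (-1))).abs) (fun n => ?_) ?_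
  · filter_upwards [hzd] with x hx
    refine abs_quotient_le_of_convex hc hx (d x) (by positivity) ?_
    rw [div_le_one (by positivity)]; linarith [(Nat.cast_nonneg n : (0 : ℝ) ≤ n)]
  · filter_upwards [hzd] with x hx
    have h1 := (hasDerivAt_energy_line he hx (d x) 0).tendsto_slope_zero
    simp only [zero_smul, add_zero, zero_add, smul_eq_mul] at h1
    refine h1.comp (tendsto_nhdsWithin_iff.2 ⟨tendsto_one_div_add_atTop_nhds_zero_nat,
      Eventually.of_forall fun n => ?_⟩)
    have : (0 : ℝ) < 1 / ((n : ℝ) + 1) := by positivity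
    exact this.ne'

/-! ### Admissible perturbations -/

section Variation

variable {e : Xi × ℝ → ℝ} {r : T3 → ℝ} {h : ℝ} {U0 : State E}

/-- For every test function there is an admissible direction with velocity `φ` in direction `i`. -/
theorem exists_perturbation (U0 : State E) (hq : 2 * E.q ≤ E.p) (hρ : 3 * E.ρ ≤ E.p) (h : ℝ)
    (i : Fin 3) {φ : T3 → ℝ} (hφ : SmoothOnTorus φ) :
    ∃ P : State E, (∀ᵐ x, vel P x = EuclideanSpace.single i (φ x)) ∧ (∀ᵐ x, ent P x = 0) ∧
      ∀ᵐ x, ∀ B, comp (xi P x) B = h * fluxField U0 B φ x i := by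
  have hp := E.four_le_p
  have hq2 := E.two_le_q
  have hflux : ∀ (B : Idx) (s : ENNReal),
      (∀ α, MemLp (fun x => dPhi B i α (defGrad U0 x)) s volume) →
      MemLp (fun x => h * fluxField U0 B φ x i) s volume := fun B s hs =>
    (memLp_finsetSum (p := s) (f := fun α x => dPhi B i α (defGrad U0 x) * pd α φ x) Finset.univ
      fun α _ => memLp_mul_smooth (hs α) (hφ.pd α)).const_mul h
  have mF : MemLp (fun x => (WithLp.toLp 2 fun a => h * fluxField U0 (Sum.inl a) φ x i : M3))
      (ENNReal.ofReal E.p) volume :=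
    MemLp.of_eval_piLp fun a => hflux _ _ fun α => memLp_dPhi_inl U0 a i α _
  -- The coefficients are in `L^p` for the cofactor and in `L^{p/2}` for the determinant; `2q ≤ p`
  -- and `3ρ ≤ p` place them in `L^q` and `L^ρ`.
  have mζ : MemLp (fun x => (WithLp.toLp 2 fun a =>
      h * fluxField U0 (Sum.inr (Sum.inl a)) φ x i : M3)) (ENNReal.ofReal E.q) volume :=
    MemLp.of_eval_piLp fun a => hflux _ _ fun α => (memLp_dPhi_cof U0 a i α).mono_exponent
      (ENNReal.ofReal_le_ofReal (by linarith))
  have mw : MemLp (fun x => h * fluxField U0 (Sum.inr (Sum.inr ())) φ x i)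
      (ENNReal.ofReal E.ρ) volume :=
    hflux _ _ fun α => (memLp_dPhi_det U0 () i α).mono_exponent
      (ENNReal.ofReal_le_ofReal (by linarith))
  have mv : MemLp (fun x => (EuclideanSpace.single i (φ x) : V3)) 2 volume := by
    obtain ⟨K, -, hK⟩ := hφ.exists_bound
    refine MemLp.of_bound (C := K) ?_ (ae_of_all _ fun x => by simpa using hK x)
    have hs : Continuous fun t : ℝ => (Pi.single i t : Fin 3 → ℝ) :=
      continuous_pi fun j => by
        by_cases hj : j = i
        · subst hj; simp only [Pi.single_eq_same]; exact continuous_id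
        · simpa [hj] using continuous_const
    have hc : Continuous fun t : ℝ => (EuclideanSpace.single i t : V3) :=
      (PiLp.continuous_toLp 2 _).comp hs
    exact (hc.comp hφ.continuous).aestronglyMeasurable
  refine ⟨(mv.toLp _, (mF.toLp _, mζ.toLp _, mw.toLp _), 0), mv.coeFn_toLp,
    Lp.coeFn_zero _ _ _, ?_⟩
  filter_upwards [mF.coeFn_toLp, mζ.coeFn_toLp, mw.coeFn_toLp] with x h1 h2 h3
  rintro (a | a | u)
  · exact congrArg (fun F : M3 => F a) h1
  · exact congrArg (fun F : M3 => F a) h2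
  · exact h3

/-- The `ξ`-term carries `ψ ∂_αφ` and the velocity term `φ ∂_αψ`. Together they are `∂_α(φψ)`
against `∂Φ^B/∂F_{iα}(F⁰)`, and the Piola identity gives zero. -/
theorem transportForm_perturbation (hh : h ≠ 0) {y0 : T3 → V3} (hy0 : MemW1 E.p y0)
    (hF0 : HasWeakGradient y0 (defGrad U0)) {i : Fin 3} {φ : T3 → ℝ} (hφ : SmoothOnTorus φ)
    {P : State E} (hv : ∀ᵐ x, vel P x = EuclideanSpace.single i (φ x))
    (hξ : ∀ᵐ x, ∀ B, comp (xi P x) B = h * fluxField U0 B φ x i)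
    (B : Idx) {ψ : T3 → ℝ} (hψ : SmoothOnTorus ψ) : transportForm h U0 B hψ P = 0 := by
  have hp := E.four_le_p
  have h1 : transportForm h U0 B hψ P = 1 / h * pairing (compCLM B) hψ (xiEntL1 P)
      + inner ℝ ((memLp_fluxField U0 B hψ).toLp _) P.1 := rfl
  have hfi : ∀ {χ : T3 → ℝ}, SmoothOnTorus χ → Integrable (fun x => fluxField U0 B χ x i) volume :=
    fun hχ => ((memLp_fluxField U0 B hχ).eval_piLp i).integrable one_le_two
  have h2 : pairing (compCLM B) hψ (xiEntL1 P) = h * ∫ x, fluxField U0 B φ x i * ψ x := by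
    rw [pairing_xiEntL1, ← integral_const_mul]
    refine integral_congr_ae ?_
    filter_upwards [hξ] with x hx
    rw [compCLM_apply]
    change ψ x * comp (xi P x) B = _
    rw [hx B]; ring
  have h3 : inner ℝ ((memLp_fluxField U0 B hψ).toLp _) P.1 = ∫ x, fluxField U0 B ψ x i * φ x := by
    rw [L2.inner_def]
    refine integral_congr_ae ?_
    filter_upwards [(memLp_fluxField U0 B hψ).coeFn_toLp, hv] with x hx hx'
    have hx'' : P.1 x = EuclideanSpace.single i (φ x) := hx'
    rw [hx, hx'', EuclideanSpace.inner_single_right]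
    simp [mul_comm]
  rw [h1, h2, h3, ← mul_assoc, one_div_mul_cancel hh, one_mul,
    ← integral_add (SmoothOnTorus.integrable_mul (hfi hφ) hψ)
      (SmoothOnTorus.integrable_mul (hfi hψ) hφ)]
  rw [← integral_dPhi_pd (fun j => (hy0.1.eval_piLp j).integrable Exponents.one_le_p)
    (fun a => ((memLp_defGrad U0).eval_piLp a).mono_exponent (two_le_ofReal (by linarith))) hF0 B i
    (hφ.mul hψ)]
  refine integral_congr_ae (ae_of_all _ fun x => ?_)
  simp only [fluxField, Finset.sum_mul, ← Finset.sum_add_distrib]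
  refine Finset.sum_congr rfl fun α _ => ?_
  rw [hφ.pd_mul hψ]; ring

theorem entropyForm_perturbation {P : State E} (hη : ∀ᵐ x, ent P x = 0) {ψ : T3 → ℝ}
    (hψ : SmoothOnTorus ψ) : entropyForm h hψ P = 0 := by
  rw [entropyForm_apply]
  have : ∫ x, ψ x * ent P x = 0 := integral_eq_zero_of_ae (by
    filter_upwards [hη] with x hx
    simp [hx])
  rw [this, mul_zero]

theorem add_smul_mem_admissible {U P : State E} (hU : U ∈ admissible e r h U0)
    (hP : ∀ (B : Idx) (ψ : T3 → ℝ) (hψ : SmoothOnTorus ψ), transportForm h U0 B hψ P = 0)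
    (hP' : ∀ (ψ : T3 → ℝ) (hψ : SmoothOnTorus ψ), entropyForm h hψ P = 0) (t : ℝ) :
    U + t • P ∈ admissible e r h U0 := by
  refine ⟨transportEq_iff.2 fun B ψ hψ => ?_, entropyEq_iff.2 fun ψ hψ => ?_⟩
  · rw [map_add, map_smul, hP, smul_zero, add_zero, transportEq_iff.1 hU.1 B ψ hψ]
  · rw [map_add, map_smul, hP', smul_zero, add_zero, entropyEq_iff.1 hU.2 ψ hψ]

/-- Minimality along `U + tP` makes the difference quotient of `J` nonnegative for `t > 0`; its
limit as `t` tends to `0` is the stated expression. -/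
theorem first_variation_nonneg (he : ContDiffOn ℝ 3 e energyDom)
    (hc : StrictConvexOn ℝ energyDom e) (hg : EnergyGrowth E e) (hd : DerivGrowth E e) (hh : h ≠ 0)
    (hent : ∀ U ∈ admissible e r h U0, ∀ᵐ x, 0 ≤ ent U x) {y0 : T3 → V3} (hy0 : MemW1 E.p y0)
    (hF0 : HasWeakGradient y0 (defGrad U0)) {U : State E} (hU : IsMinimizer e r h U0 U)
    (i : Fin 3) {φ : T3 → ℝ} (hφ : SmoothOnTorus φ) :
    0 ≤ (∫ x, φ x * (vel U x i - vel U0 x i)) + h * ∫ x, ∑ α, stress e U0 U i α x * pd α φ x := by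
  obtain ⟨P, hPv, hPη, hPξ⟩ := exists_perturbation U0 (two_mul_q_le he hg hd)
    (three_mul_ρ_le he hg hd) h i hφ
  have hadm : ∀ t : ℝ, U + t • P ∈ admissible e r h U0 :=
    add_smul_mem_admissible hU.1
      (fun B ψ hψ => transportForm_perturbation hh hy0 hF0 hφ hPv hPξ B hψ)
      (fun ψ hψ => entropyForm_perturbation hPη hψ)
  have hxi : ∀ t : ℝ, ∀ᵐ x, xiEnt (U + t • P) x = xiEnt U x + t • ((xi P x, 0) : Xi × ℝ) := by
    intro t
    have h1 := xiEnt_comb 1 t U P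
    rw [one_smul] at h1
    filter_upwards [h1, hPη] with x hx hx'
    rw [hx, one_smul]
    have : xiEnt P x = (xi P x, 0) := Prod.ext rfl hx'
    rw [this]
  have hvel : ∀ t : ℝ, ∀ᵐ x, vel (U + t • P) x
      = vel U x + t • (EuclideanSpace.single i (φ x) : V3) := by
    intro t
    have h1 := vel_comb 1 t U P
    rw [one_smul] at h1
    filter_upwards [h1, hPv] with x hx hx'
    rw [hx, one_smul, hx']
  have hUe := hent U hU.1
  have hi : ∀ t : ℝ, Integrable (fun x => e (xiEnt U x + t • ((xi P x, 0) : Xi × ℝ))) volume := by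
    intro t
    have h1 := integrable_energy he.continuousOn hg (aestronglyMeasurable_xiEnt (U + t • P))
      (hent _ (hadm t)) (integrable_gauge _)
    refine h1.congr ?_
    filter_upwards [hxi t] with x hx
    rw [hx]
  have hi0 : Integrable (fun x => e (xiEnt U x)) volume := by simpa using hi 0
  have hai : Integrable (fun x => φ x * (vel U x i - vel U0 x i)) volume := by
    have h1 : Integrable (fun x => vel U x i - vel U0 x i) volume :=
      (((memLp_vel U).eval_piLp i).integrable one_le_two).sub
        (((memLp_vel U0).eval_piLp i).integrable one_le_two)
    simpa only [mul_comm] using SmoothOnTorus.integrable_mul h1 hφ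
  have hφ2 : Integrable (fun x => 1 / 2 * (φ x * φ x)) volume := (hφ.mul hφ).integrable.const_mul _
  -- The kinetic part of the quotient is expanded exactly: a linear term and a remainder `t · ½φ²`
  -- that disappears in the limit.
  have hquot : ∀ t : ℝ, 0 < t → 0 ≤ (∫ x, φ x * (vel U x i - vel U0 x i))
      + t * (∫ x, 1 / 2 * (φ x * φ x))
      + ∫ x, t⁻¹ * (e (xiEnt U x + t • ((xi P x, 0) : Xi × ℝ)) - e (xiEnt U x)) := by
    intro t ht
    have h1 : 0 ≤ t⁻¹ * (J e U0 (U + t • P) - J e U0 U) :=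
      mul_nonneg (inv_nonneg.2 ht.le) (sub_nonneg.2 (hU.2 _ (hadm t)))
    refine h1.trans_eq ?_
    have hs : Integrable (fun x => φ x * (vel U x i - vel U0 x i) + t * (1 / 2 * (φ x * φ x)))
        volume := hai.add (hφ2.const_mul t)
    have hq : Integrable (fun x => t⁻¹ * (e (xiEnt U x + t • ((xi P x, 0) : Xi × ℝ))
        - e (xiEnt U x))) volume := ((hi t).sub hi0).const_mul _
    rw [← integral_const_mul, ← integral_add hai (hφ2.const_mul t), ← integral_add hs hq]
    unfold J
    rw [← integral_sub (integrable_energyDensity he.continuousOn hg U0 (hent _ (hadm t)))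
      (integrable_energyDensity he.continuousOn hg U0 hUe), ← integral_const_mul]
    refine integral_congr_ae ?_
    filter_upwards [hxi t, hvel t] with x hx hx'
    simp only [energyDensity, hx, hx']
    have h2 : vel U x + t • (EuclideanSpace.single i (φ x) : V3) - vel U0 x
        = (vel U x - vel U0 x) + t • (EuclideanSpace.single i (φ x) : V3) := by abel
    rw [h2, norm_add_sq_real, real_inner_smul_right, EuclideanSpace.inner_single_right, norm_smul,
      mul_pow]
    simp only [PiLp.sub_apply, conj_trivial, Real.norm_eq_abs, sq_abs, PiLp.norm_single]
    field_simp
    ring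
  have hlim := tendsto_integral_quotient he hc (z := xiEnt U) (d := xi P) hUe hi
  have hlim0 : Tendsto (fun n : ℕ => 1 / ((n : ℝ) + 1) * ∫ x, 1 / 2 * (φ x * φ x)) atTop (𝓝 0) := by
    simpa using tendsto_one_div_add_atTop_nhds_zero_nat.mul_const (∫ x, 1 / 2 * (φ x * φ x))
  have hge := ge_of_tendsto' ((hlim0.const_add (∫ x, φ x * (vel U x i - vel U0 x i))).add hlim)
    fun n => hquot _ (by positivity)
  rw [add_zero] at hge
  refine hge.trans_eq ?_
  congr 1
  rw [← integral_const_mul]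
  refine integral_congr_ae ?_
  -- Inserting `ξ^B = h ∂Φ^B/∂F_{iα}(F⁰) ∂_αφ` into the directional derivative of `ê` and exchanging
  -- the sums over `B` and `α` produces the stress.
  filter_upwards [hPξ] with x hx
  rw [fderivWithin_energy_apply]
  simp only [hx, fluxField, stress, Finset.mul_sum, Finset.sum_mul]
  rw [Finset.sum_comm]
  exact Finset.sum_congr rfl fun B _ => Finset.sum_congr rfl fun α _ => by ring

/-- The first variation is linear in `φ`, so its nonnegativity for `φ` and `-φ` forces it to vanish.
-/
theorem momentumEq_of_isMinimizer (he : ContDiffOn ℝ 3 e energyDom)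
    (hc : StrictConvexOn ℝ energyDom e) (hg : EnergyGrowth E e) (hd : DerivGrowth E e) (hh : h ≠ 0)
    (hent : ∀ U ∈ admissible e r h U0, ∀ᵐ x, 0 ≤ ent U x) {y0 : T3 → V3} (hy0 : MemW1 E.p y0)
    (hF0 : HasWeakGradient y0 (defGrad U0)) {U : State E} (hU : IsMinimizer e r h U0 U) :
    MomentumEq e h U0 U := by
  refine ⟨integrable_stress he hd U0 (hent U hU.1), fun i φ hφ => ?_⟩
  have h1 := first_variation_nonneg he hc hg hd hh hent hy0 hF0 hU i hφ
  have h2 := first_variation_nonneg he hc hg hd hh hent hy0 hF0 hU i hφ.neg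
  simp only [hφ.pd_neg, neg_mul, mul_neg, Finset.sum_neg_distrib, integral_neg] at h2
  have h3 : ∫ x, φ x * (1 / h * (vel U x i - vel U0 x i))
      = 1 / h * ∫ x, φ x * (vel U x i - vel U0 x i) := by
    rw [← integral_const_mul]
    refine integral_congr_ae (ae_of_all _ fun x => ?_)
    ring
  have h4 : ∫ x, φ x * (vel U x i - vel U0 x i)
      = -(h * ∫ x, ∑ α, stress e U0 U i α x * pd α φ x) := by linarith
  rw [h3, h4]; field_simp

end Variation

end PolyThermo

end

/-! ### The main theorem -/

open PolyThermo MeasureTheory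
theorem mainTheorem3
    (E : Exponents) (e : Xi × ℝ → ℝ) (r : T3 → ℝ) (h : ℝ) (U0 : State E) (y0 : T3 → V3)
    (hh : 0 < h)
    -- the internal energy
    (he_smooth : ContDiffOn ℝ 3 e energyDom)
    (he_convex : StrictConvexOn ℝ energyDom e)
    (he_growth : EnergyGrowth E e)
    -- the initial data: `F⁰ = ∇y⁰` with `y⁰ ∈ W^{1,p}`, and `η⁰ ≥ 0`
    (hy0 : MemW1 E.p y0)
    (hF0 : HasWeakGradient y0 (defGrad U0))
    (hη0 : ∀ᵐ x, 0 ≤ ent U0 x)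
    -- the entropy update is well defined and stays in the domain of the energy
    (hθ : ∀ᵐ x, theta e (xiEnt U0 x) ≠ 0)
    (hr : MemLp (fun x => r x / theta e (xiEnt U0 x)) (ENNReal.ofReal E.l) volume)
    (hη : ∀ᵐ x, 0 ≤ ent U0 x + h * (r x / theta e (xiEnt U0 x))) :
    -- the admissible set is a weakly closed affine subspace
    (∃ A : AffineSubspace ℝ (State E), (A : Set (State E)) = admissible e r h U0) ∧
    IsClosed (toWeakSpace ℝ (State E) '' admissible e r h U0) ∧
    -- on which the functional is given by a convergent integral
    (∀ U ∈ admissible e r h U0,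
      (∀ᵐ x, 0 ≤ ent U x) ∧ Integrable (energyDensity e U0 U) volume) ∧
    -- existence and uniqueness of the minimizer
    (∃! U : State E, IsMinimizer e r h U0 U) ∧
    -- the Euler-Lagrange equation
    (DerivGrowth E e → ∀ U : State E, IsMinimizer e r h U0 U → MomentumEq e h U0 U) ∧
    -- every admissible state, in particular the minimizer, inherits the gradient constraint
    (∀ U ∈ admissible e r h U0,
      CurlFree (defGrad U) ∧
      ∃ y : T3 → V3, MemW1 E.p y ∧ HasWeakGradient y (defGrad U)) := by
  have hh0 : h ≠ 0 := hh.ne'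
  have hent : ∀ U ∈ admissible e r h U0, ∀ᵐ x, 0 ≤ ent U x := fun U hU => by
    filter_upwards [ent_eq_of_mem_admissible hh0 hr hU, hη] with x h1 h2
    rw [h1]; exact h2
  have hec := he_smooth.continuousOn
  refine ⟨exists_affineSubspace_admissible, isClosed_toWeakSpace_admissible, fun U hU =>
    ⟨hent U hU, integrable_energyDensity hec he_growth U0 (hent U hU)⟩, ?_, fun hd U hU =>
    momentumEq_of_isMinimizer he_smooth he_convex he_growth hd hh0 hent hy0 hF0 hU,
    fun U hU => gradient_constraint hh0 hy0 hF0 hU⟩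
  obtain ⟨U, hU⟩ := exists_minimizer hec he_convex he_growth hent (admissible_nonempty hh0 hr)
  exact ⟨U, hU, fun V hV => minimizer_unique hec he_convex he_growth hent hV hU⟩
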